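/- Let $\varepsilon\in\mathbb R$, $\alpha_1\in C^2(\mathbb R^3)$, $\rho_1\in C^1(\mathbb R^3)$ be real-valued, and let $x,y\in\mathbb R^3$ with $x\neq y$. For $t\in\mathbb R$ put $\mathscr E_t(x,y)=\{z\in\mathbb R^3 : |z-x|+|z-y|\le t\}$ and $$\begin{aligned}K(t,x,y;\varepsilon) &= \frac{(t-|y-x|)^2}{8\pi|y-x|}\bigl(1-\varepsilon\alpha_1(y)\bigr)+\int_{\mathscr E_t(x,y)}\frac{1}{16\pi^2|z-x||z-y|}\,\varepsilon\alpha_1(z)\,dz\\ &\quad+\int_{\mathscr E_t(x,y)}\frac{t-|z-x|-|z-y|}{16\pi^2|z-x||z-y|}\,\varepsilon\nabla\rho_1(z)\cdot\frac{z-y}{|z-y|}\,dz\\ &\quad+\int_{\mathscr E_t(x,y)}\frac{(t-|z-x|-|z-y|)^2}{32\pi^2|z-x||z-y|^2}\,\varepsilon\nabla\rho_1(z)\cdot\frac{z-y}{|z-y|}\,dz .\end{aligned}$$ Let $L_{x,y}$ be the straight line segment from $x$ to $y$, and let $ds$ denote arc length on it. Then the integrals defining $K$ converge absolutely for every $t$,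 the function $t\mapsto K(t,x,y;\varepsilon)$ is twice differentiable on $(|y-x|,\infty)$, and $$\lim_{t\downarrow|y-x|}\frac{\partial}{\partial t}K(t,x,y;\varepsilon)=\frac{1}{8\pi|y-x|}\int_{L_{x,y}}\varepsilon\alpha_1(z)\,ds(z),$$ $$\lim_{t\downarrow|y-x|}\frac{\partial^2}{\partial t^2}K(t,x,y;\varepsilon)=\frac{1-\varepsilon\alpha_1(y)}{4\pi|y-x|}+\frac{\varepsilon\rho_1(x)-\varepsilon\rho_1(y)}{8\pi|y-x|}+\frac{1}{16\pi|y-x|}\int_{L_{x,y}}\Bigl(1-\frac{|z-x|}{|y-x|}\Bigr)|z-x|\,\varepsilon\Delta\alpha_1(z)\,ds(z).$$ -/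

import Mathlib

open MeasureTheory Filter Topology

/-- Three-dimensional Euclidean space. -/
abbrev E3 : Type := EuclideanSpace ℝ (Fin 3)

/-- The (filled, closed) prolate spheroid with focal points `x`, `y` and major axis `t`. -/
def spheroid (x y : E3) (t : ℝ) : Set E3 :=
  {z : E3 | ‖z - x‖ + ‖z - y‖ ≤ t}

/-- The directional derivative `∇ρ₁(z) · (z - y) / |z - y|`. -/
noncomputable def radialGrad (ρ₁ : E3 → ℝ) (y z : E3) : ℝ :=
  inner ℝ (gradient ρ₁ z) (‖z - y‖⁻¹ • (z - y))

/-- Integrand of the `α₁`-term of the kernel. -/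
noncomputable def kernelAlpha (ε : ℝ) (α₁ : E3 → ℝ) (x y z : E3) : ℝ :=
  1 / (16 * Real.pi ^ 2 * ‖z - x‖ * ‖z - y‖) * (ε * α₁ z)

/-- Integrand of the first `ρ₁`-term of the kernel. -/
noncomputable def kernelRhoA (ε : ℝ) (ρ₁ : E3 → ℝ) (x y : E3) (t : ℝ) (z : E3) : ℝ :=
  (t - ‖z - x‖ - ‖z - y‖) / (16 * Real.pi ^ 2 * ‖z - x‖ * ‖z - y‖) * (ε * radialGrad ρ₁ y z)

/-- Integrand of the second `ρ₁`-term of the kernel. -/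
noncomputable def kernelRhoB (ε : ℝ) (ρ₁ : E3 → ℝ) (x y : E3) (t : ℝ) (z : E3) : ℝ :=
  (t - ‖z - x‖ - ‖z - y‖) ^ 2 / (32 * Real.pi ^ 2 * ‖z - x‖ * ‖z - y‖ ^ 2) *
    (ε * radialGrad ρ₁ y z)

/-- The kernel `K(t, x, y; ε)`. -/
noncomputable def waveKernel (ε : ℝ) (α₁ ρ₁ : E3 → ℝ) (x y : E3) (t : ℝ) : ℝ :=
  (t - ‖y - x‖) ^ 2 / (8 * Real.pi * ‖y - x‖) * (1 - ε * α₁ y)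
    + (∫ z in spheroid x y t, kernelAlpha ε α₁ x y z)
    + (∫ z in spheroid x y t, kernelRhoA ε ρ₁ x y t z)
    + (∫ z in spheroid x y t, kernelRhoB ε ρ₁ x y t z)

/-- The line integral `∫ f ds` over the segment from `x` to `y`, by arc-length
parametrisation. -/
noncomputable def segmentIntegral (f : E3 → ℝ) (x y : E3) : ℝ :=
  ∫ s in (0 : ℝ)..‖y - x‖, f (x + (s / ‖y - x‖) • (y - x))

/-! With `d = |y - x|`, use prolate spheroidal coordinates with foci `x`, `y`: `τ = |z - x| + |z -
y|`, `σ = |z - x| - |z - y|` and the azimuth `φ`. Then `dz = (τ² - σ²)/(8d) dτ dσ dφ` and `|z - x||z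
- y| = (τ² - σ²)/4`, so the singular weight cancels the Jacobian and leaves the constant `1/(2d)`.
Hence (`waveKernel_eq`) `K` is a quadratic in `t - d` plus multiples of `∫ hA`, `∫ (t - τ) hG` and
`∫ (t - τ)² hB` over `[d, t]`, where `hA`, `hG`, `hB` integrate `α₁`, the radial derivative of `ρ₁`,
and that derivative divided by `|z - y|` over `(σ, φ)`. Differentiating twice (`deriv_kernel_form`)
leaves the limits at `τ = d` of `hA`, `hA'` and `hG`; the `hB` term only has to be integrable, which
follows from `τ - σ ≥ 2 √(τ - d) √(d - σ)`.

At `τ = d` the spheroid collapses to the segment. So `hA` tends to a line integral, and `hG` to the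
integral of `-∂ρ₁` along the axis, which is a boundary difference.

The delicate limit is `hA'`, because the distance `R` to the axis contains `√(τ² - d²)`, whose
derivative blows up at `τ = d`. Averaging over `φ ↦ φ + π` replaces the transversal first derivative
by a difference at `±R`, which is `R` times an integral of second derivatives, and `R R'` is regular
(`hasDerivAt_symMean`). In the limit the mean over `φ` gives the two transversal second derivatives;
integrating the axial term by parts gives the third with the same weight, and the Laplacian appears
(`integral_symMeanDeriv_focal`). -/

/-- The planar elliptic coordinate change `(τ, σ) ↦ (axial coordinate, distance to the axis)`
for the focal distance `d`. -/
noncomputable def axialRadial (d : ℝ) (p : ℝ × ℝ) : ℝ × ℝ :=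
  (p.1 * p.2 / (2 * d), √(p.1 ^ 2 - d ^ 2) * √(d ^ 2 - p.2 ^ 2) / (2 * d))

/-- The derivative of `axialRadial`. -/
noncomputable def axialRadialFDeriv (d : ℝ) (p : ℝ × ℝ) : ℝ × ℝ →L[ℝ] ℝ × ℝ :=
  (Matrix.toLin (.finTwoProd ℝ) (.finTwoProd ℝ)
    !![p.2 / (2 * d), p.1 / (2 * d);
      p.1 / √(p.1 ^ 2 - d ^ 2) * √(d ^ 2 - p.2 ^ 2) / (2 * d),
      -(√(p.1 ^ 2 - d ^ 2) * (p.2 / √(d ^ 2 - p.2 ^ 2))) / (2 * d)]).toContinuousLinearMap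

/-! ### Elliptic coordinates in the half-plane. -/

section Elliptic

variable {d : ℝ}

theorem hasFDerivAt_axialRadial {p : ℝ × ℝ} (h₁ : 0 < p.1 ^ 2 - d ^ 2)
    (h₂ : 0 < d ^ 2 - p.2 ^ 2) :
    HasFDerivAt (axialRadial d) (axialRadialFDeriv d p) p := by
  have hf : HasFDerivAt (fun p : ℝ × ℝ => p.1) (ContinuousLinearMap.fst ℝ ℝ ℝ) p := hasFDerivAt_fst
  have hs : HasFDerivAt (fun p : ℝ × ℝ => p.2) (ContinuousLinearMap.snd ℝ ℝ ℝ) p := hasFDerivAt_snd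
  have e1 := (hf.mul hs).mul_const ((2 * d)⁻¹)
  have e2 := (((hf.pow 2).sub_const (d ^ 2)).sqrt h₁.ne').mul
    (((hs.pow 2).const_sub (d ^ 2)).sqrt h₂.ne') |>.mul_const ((2 * d)⁻¹)
  have key := e1.prodMk e2
  unfold axialRadialFDeriv
  rw [Matrix.toLin_finTwoProd_toContinuousLinearMap]
  have s1 := (Real.sqrt_pos.2 h₁).ne'
  have s2 := (Real.sqrt_pos.2 h₂).ne'
  refine key.congr_fderiv ?_
  ext <;> simp <;> field_simp 

/-- The planar determinant has both square roots in its denominator; the cylindrical factor `r` has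
them in its numerator, so the three-dimensional Jacobian is polynomial in `τ`, `σ`. -/
theorem abs_det_axialRadialFDeriv (hd : 0 < d) {p : ℝ × ℝ} (h₁ : d < p.1)
    (h₂ : p.2 ∈ Set.Ioo (-d) d) :
    |(axialRadialFDeriv d p).det| * (axialRadial d p).2 = (p.1 ^ 2 - p.2 ^ 2) / (8 * d) := by
  obtain ⟨h₃, h₄⟩ := h₂
  have a1 : 0 < p.1 ^ 2 - d ^ 2 := by nlinarith
  have a2 : 0 < d ^ 2 - p.2 ^ 2 := by nlinarith
  have s1 := Real.sqrt_pos.2 a1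
  have s2 := Real.sqrt_pos.2 a2
  have q1 := Real.sq_sqrt a1.le
  have q2 := Real.sq_sqrt a2.le
  have hdet : (axialRadialFDeriv d p).det =
      -((p.1 ^ 2 - p.2 ^ 2) / (4 * √(p.1 ^ 2 - d ^ 2) * √(d ^ 2 - p.2 ^ 2))) := by
    unfold axialRadialFDeriv
    simp only [LinearMap.det_toContinuousLinearMap, LinearMap.det_toLin, Matrix.det_fin_two_of]
    generalize √(p.1 ^ 2 - d ^ 2) = a at *
    generalize √(d ^ 2 - p.2 ^ 2) = b at *
    field_simp
    rw [q1, q2]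
    ring
  have : 0 < p.1 ^ 2 - p.2 ^ 2 := by linarith
  rw [hdet, abs_neg, abs_of_pos (by positivity), axialRadial]
  field_simp
  ring

/-- The coordinates are the sum and the difference of the distances to the foci `(±d/2, 0)`. This
inverts the map, and gives injectivity at once. -/
theorem axialRadial_focal (hd : 0 < d) {p : ℝ × ℝ} (h₁ : d ≤ p.1)
    (h₂ : p.2 ∈ Set.Icc (-d) d) :
    √(((axialRadial d p).1 + d / 2) ^ 2 + (axialRadial d p).2 ^ 2) = (p.1 + p.2) / 2 ∧
    √(((axialRadial d p).1 - d / 2) ^ 2 + (axialRadial d p).2 ^ 2) = (p.1 - p.2) / 2 := by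
  obtain ⟨h₃, h₄⟩ := h₂
  have a1 : 0 ≤ p.1 ^ 2 - d ^ 2 := by nlinarith
  have a2 : 0 ≤ d ^ 2 - p.2 ^ 2 := by nlinarith
  have q1 := Real.sq_sqrt a1
  have q2 := Real.sq_sqrt a2
  constructor
  · rw [← Real.sqrt_sq (show 0 ≤ (p.1 + p.2) / 2 by linarith)]
    congr 1
    simp only [axialRadial, div_pow, mul_pow, q1, q2]
    field_simp
    ring
  · rw [← Real.sqrt_sq (show 0 ≤ (p.1 - p.2) / 2 by linarith)]
    congr 1
    simp only [axialRadial, div_pow, mul_pow, q1, q2]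
    field_simp
    ring

theorem injOn_axialRadial (hd : 0 < d) :
    Set.InjOn (axialRadial d) (Set.Ioi d ×ˢ Set.Ioo (-d) d) := by
  intro p hp q hq h
  have ep := axialRadial_focal hd (le_of_lt hp.1) (Set.Ioo_subset_Icc_self hp.2)
  have eq := axialRadial_focal hd (le_of_lt hq.1) (Set.Ioo_subset_Icc_self hq.2)
  rw [h] at ep
  have e1 := ep.1.symm.trans eq.1
  have e2 := ep.2.symm.trans eq.2
  ext <;> linarith

theorem image_axialRadial (hd : 0 < d) :
    axialRadial d '' (Set.Ioi d ×ˢ Set.Ioo (-d) d) = Set.univ ×ˢ Set.Ioi 0 := by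
  ext ⟨w, r⟩
  constructor
  · rintro ⟨p, ⟨h1, h3, h4⟩, hp⟩
    have h1 : d < p.1 := h1
    have a1 : 0 < p.1 ^ 2 - d ^ 2 := by nlinarith
    have a2 : 0 < d ^ 2 - p.2 ^ 2 := by nlinarith
    have s1 := Real.sqrt_pos.2 a1
    have s2 := Real.sqrt_pos.2 a2
    rw [← hp]
    refine ⟨trivial, ?_⟩
    simp only [axialRadial, Set.mem_Ioi]
    positivity
  · rintro ⟨-, hr⟩
    have hr : 0 < r := hr
    have n1 : 0 ≤ (w + d / 2) ^ 2 + r ^ 2 := by positivity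
    have n2 : 0 ≤ (w - d / 2) ^ 2 + r ^ 2 := by positivity
    have q1 := Real.sq_sqrt n1
    have q2 := Real.sq_sqrt n2
    have b1 : |w + d / 2| < √((w + d / 2) ^ 2 + r ^ 2) :=
      Real.lt_sqrt_of_sq_lt (by rw [sq_abs]; nlinarith)
    have b2 : |w - d / 2| < √((w - d / 2) ^ 2 + r ^ 2) :=
      Real.lt_sqrt_of_sq_lt (by rw [sq_abs]; nlinarith)
    rw [abs_lt] at b1 b2
    have p1 := Real.sqrt_nonneg ((w + d / 2) ^ 2 + r ^ 2)
    have p2 := Real.sqrt_nonneg ((w - d / 2) ^ 2 + r ^ 2)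
    generalize √((w + d / 2) ^ 2 + r ^ 2) = A at *
    generalize √((w - d / 2) ^ 2 + r ^ 2) = B at *
    have g1 : d < A + B := by linarith [b1.2, b2.1]
    -- Squaring `A ≥ B + d` and using `A² - B² = 2dw` would give `B ≤ w - d/2`, against the strict
    -- bound that `r > 0` provides. The next bound is symmetric.
    have g2 : A - B < d := by
      refine lt_of_not_ge fun h => ?_
      nlinarith [b2.2]
    have g3 : -d < A - B := by
      refine lt_of_not_ge fun h => ?_
      nlinarith [b1.1]
    refine ⟨(A + B, A - B), ⟨g1, g3, g2⟩, ?_⟩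
    have a1 : 0 ≤ (A + B) ^ 2 - d ^ 2 := by nlinarith
    simp only [axialRadial]
    rw [← Real.sqrt_mul a1]
    have e : ((A + B) ^ 2 - d ^ 2) * (d ^ 2 - (A - B) ^ 2) = (2 * d * r) ^ 2 := by
      have : (A + B) ^ 2 * (A - B) ^ 2 = (A ^ 2 - B ^ 2) ^ 2 := by ring
      have h3 : (A + B) ^ 2 + (A - B) ^ 2 = 2 * (A ^ 2 + B ^ 2) := by ring
      have : ((A + B) ^ 2 - d ^ 2) * (d ^ 2 - (A - B) ^ 2)
        = d ^ 2 * (2 * (A ^ 2 + B ^ 2)) - d ^ 4 - (A ^ 2 - B ^ 2) ^ 2 := by ring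
      rw [this, q1, q2]
      ring
    rw [e, Real.sqrt_sq (by positivity)]
    have : (A + B) * (A - B) = 2 * d * w := by
      have : (A + B) * (A - B) = A ^ 2 - B ^ 2 := by ring
      rw [this, q1, q2]; ring
    rw [this]
    ext <;> field_simp

theorem lintegral_axialRadial (hd : 0 < d) (g : ℝ × ℝ → ENNReal) :
    ∫⁻ q in Set.univ ×ˢ Set.Ioi 0, ENNReal.ofReal q.2 * g q =
      ∫⁻ p in Set.Ioi d ×ˢ Set.Ioo (-d) d,
        ENNReal.ofReal ((p.1 ^ 2 - p.2 ^ 2) / (8 * d)) * g (axialRadial d p) := by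
  have hm : MeasurableSet (Set.Ioi d ×ˢ Set.Ioo (-d) d) := measurableSet_Ioi.prod measurableSet_Ioo
  rw [← image_axialRadial hd, lintegral_image_eq_lintegral_abs_det_fderiv_mul volume hm
    (fun p hp => ?_) (injOn_axialRadial hd)]
  rotate_left 2
  · have h1 : d < p.1 := hp.1
    have h3 := hp.2.1
    have h4 := hp.2.2
    exact (hasFDerivAt_axialRadial (by nlinarith) (by nlinarith)).hasFDerivWithinAt
  refine setLIntegral_congr_fun hm fun p hp => ?_
  rw [← mul_assoc, ← ENNReal.ofReal_mul (abs_nonneg _), abs_det_axialRadialFDeriv hd hp.1 hp.2]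

end Elliptic

/-! ### Lebesgue measure in prolate spheroidal coordinates. -/

/-- Prolate spheroidal coordinates `(τ, σ, φ)` with centre `c`, axis `b 0` and focal distance
`d`. -/
noncomputable def spheroidal (b : OrthonormalBasis (Fin 3) ℝ E3) (c : E3) (d : ℝ)
    (p : ℝ × ℝ × ℝ) : E3 :=
  c + (axialRadial d (p.1, p.2.1)).1 • b 0 +
    (axialRadial d (p.1, p.2.1)).2 • (Real.cos p.2.2 • b 1 + Real.sin p.2.2 • b 2)

/-- Lebesgue measure on the range of the coordinates `(σ, φ)`. -/
noncomputable def sectionMeasure (d : ℝ) : Measure (ℝ × ℝ) :=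
  (volume.restrict (Set.Ioo (-d) d)).prod (volume.restrict (Set.Ioo (-Real.pi) Real.pi))

instance (d : ℝ) : IsFiniteMeasure (sectionMeasure d) := by
  unfold sectionMeasure; infer_instance

section Coordinates

variable (b : OrthonormalBasis (Fin 3) ℝ E3) (c : E3) {d : ℝ}

theorem measurePreserving_frame :
    MeasurePreserving (fun q : ℝ × ℝ × ℝ => c + q.1 • b 0 + q.2.1 • b 1 + q.2.2 • b 2) := by
  have h1 : MeasurePreserving (Prod.map id (MeasurableEquiv.finTwoArrow (α := ℝ)).symm)
      (volume : Measure (ℝ × ℝ × ℝ)) (volume : Measure (ℝ × (Fin 2 → ℝ))) :=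
    (MeasurePreserving.id volume).prod (volume_preserving_finTwoArrow ℝ).symm
  have h2 := (volume_preserving_piFinSuccAbove (fun _ : Fin 3 => ℝ) 0).symm
  have h3 := PiLp.volume_preserving_toLp (Fin 3)
  have h4 := b.measurePreserving_repr_symm
  have h5 := measurePreserving_add_left (volume : Measure E3) c
  have h := h5.comp (h4.comp (h3.comp (h2.comp h1)))
  have e : (fun q : ℝ × ℝ × ℝ => c + q.1 • b 0 + q.2.1 • b 1 + q.2.2 • b 2) =
      (fun z => c + z) ∘ b.repr.symm ∘ WithLp.toLp 2 ∘
        (MeasurableEquiv.piFinSuccAbove (fun _ : Fin 3 => ℝ) 0).symm ∘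
          Prod.map id (MeasurableEquiv.finTwoArrow (α := ℝ)).symm := by
    ext1 q
    simp only [Function.comp_apply]
    rw [← b.sum_repr (b.repr.symm _)]
    simp [Fin.sum_univ_three, add_assoc]
  rw [e]
  exact h

theorem continuous_axialRadial : Continuous (axialRadial d) := by
  unfold axialRadial; fun_prop

theorem continuous_spheroidal : Continuous (spheroidal b c d) := by
  unfold spheroidal axialRadial; fun_prop

theorem norm_frame (w r φ : ℝ) :
    ‖w • b 0 + r • (Real.cos φ • b 1 + Real.sin φ • b 2)‖ = √(w ^ 2 + r ^ 2) := by
  rw [← Real.sqrt_sq (norm_nonneg _), ← b.repr.norm_map, EuclideanSpace.norm_sq_eq]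
  congr 1
  simp [Fin.sum_univ_three]
  linear_combination r ^ 2 * Real.sin_sq_add_cos_sq φ

theorem norm_spheroidal_sub (hd : 0 < d) {p : ℝ × ℝ × ℝ} (h₁ : d ≤ p.1)
    (h₂ : p.2.1 ∈ Set.Icc (-d) d) :
    ‖spheroidal b c d p - (c - (d / 2) • b 0)‖ = (p.1 + p.2.1) / 2 ∧
    ‖spheroidal b c d p - (c + (d / 2) • b 0)‖ = (p.1 - p.2.1) / 2 := by
  obtain ⟨e1, e2⟩ := axialRadial_focal hd (p := (p.1, p.2.1)) h₁ h₂
  simp only at e1 e2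
  rw [← e1, ← e2, ← norm_frame b _ _ p.2.2, ← norm_frame b _ _ p.2.2]
  constructor <;> congr 1 <;> unfold spheroidal <;> module

/-- Cylindrical coordinates about the axis, followed by the elliptic change in the half-plane of
axial and radial coordinates. Nonnegative integrands let Tonelli reorder freely. -/
theorem lintegral_spheroidal (hd : 0 < d) {f : E3 → ENNReal} (hf : Measurable f) :
    ∫⁻ z, f z = ∫⁻ p, ENNReal.ofReal ((p.1 ^ 2 - p.2.1 ^ 2) / (8 * d)) * f (spheroidal b c d p)
      ∂((volume.restrict (Set.Ioi d)).prod (sectionMeasure d)) := by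
  set F : ℝ × ℝ × ℝ → E3 := fun q => c + q.1 • b 0 + q.2.1 • b 1 + q.2.2 • b 2 with hF
  have hFc : Continuous F := by fun_prop
  have hFm : Measurable F := hFc.measurable
  set G : (ℝ × ℝ) × ℝ → E3 :=
    fun q => F (q.1.1, q.1.2 * Real.cos q.2, q.1.2 * Real.sin q.2) with hG
  have hGm : Measurable G := by
    have : Continuous G := by fun_prop
    exact this.measurable
  set g : ℝ × ℝ → ENNReal :=
    fun q => ∫⁻ φ in Set.Ioo (-Real.pi) Real.pi, f (G (q, φ)) with hg
  have hgm : Measurable g := Measurable.lintegral_prod_right (hf.comp hGm)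
  have key : ∀ p : ℝ × ℝ, ∀ φ, G (axialRadial d p, φ) = spheroidal b c d (p.1, p.2, φ) := by
    intro p φ
    simp only [hG, hF, spheroidal]
    module
  have hJ : Measurable fun p : ℝ × ℝ => ENNReal.ofReal ((p.1 ^ 2 - p.2 ^ 2) / (8 * d)) := by
    fun_prop
  have hsm : Measurable (spheroidal b c d) := (continuous_spheroidal b c).measurable
  calc ∫⁻ z, f z = ∫⁻ q : ℝ × ℝ × ℝ, f (F q) :=
        ((measurePreserving_frame b c).lintegral_comp hf).symm
    _ = ∫⁻ w : ℝ, ∫⁻ q : ℝ × ℝ, f (F (w, q)) := by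
        exact lintegral_prod _ (hf.comp hFm).aemeasurable
    _ = ∫⁻ w : ℝ, ∫⁻ r in Set.Ioi 0, ENNReal.ofReal r * g (w, r) := by
        refine lintegral_congr fun w => ?_
        rw [← lintegral_comp_polarCoord_symm, polarCoord_target, Measure.volume_eq_prod,
          ← Measure.prod_restrict, lintegral_prod]
        · refine lintegral_congr fun r => ?_
          simp only [hg]
          rw [← lintegral_const_mul]
          · rfl
          · exact (hf.comp hGm).comp (by fun_prop : Measurable fun φ : ℝ => ((w, r), φ))
        · refine Measurable.aemeasurable ?_
          refine (ENNReal.measurable_ofReal.comp measurable_fst).smul ?_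
          exact (hf.comp hFm).comp (measurable_const.prodMk continuous_polarCoord_symm.measurable)
    _ = ∫⁻ q in Set.univ ×ˢ Set.Ioi 0, ENNReal.ofReal q.2 * g q := by
        rw [Measure.volume_eq_prod, ← Measure.prod_restrict, Measure.restrict_univ, lintegral_prod]
        exact (Measurable.mul (ENNReal.measurable_ofReal.comp measurable_snd) hgm).aemeasurable
    _ = ∫⁻ p in Set.Ioi d ×ˢ Set.Ioo (-d) d,
          ENNReal.ofReal ((p.1 ^ 2 - p.2 ^ 2) / (8 * d)) * g (axialRadial d p) :=
        lintegral_axialRadial hd g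
    _ = ∫⁻ τ in Set.Ioi d, ∫⁻ σ in Set.Ioo (-d) d,
          ENNReal.ofReal ((τ ^ 2 - σ ^ 2) / (8 * d)) * g (axialRadial d (τ, σ)) := by
        rw [Measure.volume_eq_prod, ← Measure.prod_restrict, lintegral_prod]
        exact (hJ.mul (hgm.comp continuous_axialRadial.measurable)).aemeasurable
    _ = _ := by
        rw [lintegral_prod]
        · refine lintegral_congr fun τ => ?_
          rw [sectionMeasure, lintegral_prod]
          · refine lintegral_congr fun σ => ?_
            simp only [hg, key]
            exact (lintegral_const_mul _ (hf.comp (hsm.comp (by fun_prop)))).symm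
          · exact (Measurable.mul (by fun_prop) (hf.comp (hsm.comp (by fun_prop)))).aemeasurable
        · exact (Measurable.mul (by fun_prop) (hf.comp hsm)).aemeasurable

/-- Lebesgue measure in prolate spheroidal coordinates. -/
theorem map_spheroidal (hd : 0 < d) :
    Measure.map (spheroidal b c d) (((volume.restrict (Set.Ioi d)).prod
      (sectionMeasure d)).withDensity
        fun p => ENNReal.ofReal ((p.1 ^ 2 - p.2.1 ^ 2) / (8 * d))) = volume := by
  have hsm : Measurable (spheroidal b c d) := (continuous_spheroidal b c).measurable
  refine Measure.ext_of_lintegral _ fun f hf => ?_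
  rw [lintegral_map hf hsm, lintegral_spheroidal b c hd hf]
  exact lintegral_withDensity_eq_lintegral_mul _ (by fun_prop) (hf.comp hsm)

end Coordinates

/-! ### Integrals over a spheroid as iterated integrals. -/

section SpheroidIntegral

variable (b : OrthonormalBasis (Fin 3) ℝ E3) (c : E3) {d : ℝ}

theorem ae_prod_sectionMeasure {s : Set ℝ} (hs : MeasurableSet s) :
    ∀ᵐ p ∂((volume.restrict s).prod (sectionMeasure d)),
      p.1 ∈ s ∧ p.2.1 ∈ Set.Ioo (-d) d ∧ p.2.2 ∈ Set.Ioo (-Real.pi) Real.pi := by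
  rw [sectionMeasure, Measure.prod_restrict, Measure.prod_restrict]
  exact ae_restrict_mem (hs.prod (measurableSet_Ioo.prod measurableSet_Ioo))

theorem ae_sectionMeasure :
    ∀ᵐ p ∂(sectionMeasure d),
      p.1 ∈ Set.Ioo (-d) d ∧ p.2 ∈ Set.Ioo (-Real.pi) Real.pi := by
  rw [sectionMeasure, Measure.prod_restrict]
  exact ae_restrict_mem (measurableSet_Ioo.prod measurableSet_Ioo)

theorem isClosed_spheroid (x y : E3) (t : ℝ) : IsClosed (spheroid x y t) :=
  isClosed_le (by fun_prop) continuous_const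

/-- The spheroid is the slab `τ ≤ t`, since `τ` is the sum of the focal distances. For `t ≤ d` both
sides are zero. -/
theorem volume_restrict_spheroid (hd : 0 < d) (t : ℝ) :
    (volume : Measure E3).restrict (spheroid (c - (d / 2) • b 0) (c + (d / 2) • b 0) t) =
      Measure.map (spheroidal b c d) (((volume.restrict (Set.Ioc d t)).prod
        (sectionMeasure d)).withDensity
          fun p => ENNReal.ofReal ((p.1 ^ 2 - p.2.1 ^ 2) / (8 * d))) := by
  have hsm : Measurable (spheroidal b c d) := (continuous_spheroidal b c).measurable
  have hS := (isClosed_spheroid (c - (d / 2) • b 0) (c + (d / 2) • b 0) t).measurableSet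
  rw [← map_spheroidal b c hd, Measure.restrict_map hsm hS, restrict_withDensity (hsm hS)]
  congr 2
  have h1 : (spheroidal b c d ⁻¹' spheroid (c - (d / 2) • b 0) (c + (d / 2) • b 0) t : Set _)
      =ᵐ[(volume.restrict (Set.Ioi d)).prod (sectionMeasure d)] Set.Iic t ×ˢ Set.univ := by
    filter_upwards [ae_prod_sectionMeasure (d := d) measurableSet_Ioi] with p hp
    obtain ⟨e1, e2⟩ := norm_spheroidal_sub b c hd (le_of_lt hp.1)
      (Set.Ioo_subset_Icc_self hp.2.1)
    refine propext ?_
    change _ + _ ≤ t ↔ _ ∧ _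
    rw [e1, e2]
    simp
    constructor <;> intro h <;> linarith
  rw [Measure.restrict_congr_set h1, ← Measure.prod_restrict, Measure.restrict_univ,
    Measure.restrict_restrict measurableSet_Iic, Set.inter_comm, Set.Ioi_inter_Iic]

variable {k : E3 → ℝ} {q : ℝ → ℝ}

/-- The cancellation behind the whole proof: the product of the focal distances is `(τ² - σ²)/4`. -/
theorem ae_jacobian_mul_eq (hd : 0 < d) (t : ℝ) :
    (fun p : ℝ × ℝ × ℝ => (ENNReal.ofReal ((p.1 ^ 2 - p.2.1 ^ 2) / (8 * d))).toReal •
      (q (‖spheroidal b c d p - (c - (d / 2) • b 0)‖ +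
          ‖spheroidal b c d p - (c + (d / 2) • b 0)‖) /
        (‖spheroidal b c d p - (c - (d / 2) • b 0)‖ *
          ‖spheroidal b c d p - (c + (d / 2) • b 0)‖) * k (spheroidal b c d p)))
    =ᵐ[(volume.restrict (Set.Ioc d t)).prod (sectionMeasure d)]
      fun p => 1 / (2 * d) * (q p.1 * k (spheroidal b c d p)) := by
  filter_upwards [ae_prod_sectionMeasure (d := d) measurableSet_Ioc] with p hp
  obtain ⟨⟨h1, h2⟩, ⟨h3, h4⟩, -⟩ := hp
  obtain ⟨e1, e2⟩ := norm_spheroidal_sub b c hd h1.le ⟨h3.le, h4.le⟩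
  rw [e1, e2, smul_eq_mul, ENNReal.toReal_ofReal]
  · have a1 : p.1 + p.2.1 ≠ 0 := by linarith
    have a2 : p.1 - p.2.1 ≠ 0 := by linarith
    have a3 : (p.1 + p.2.1) / 2 + (p.1 - p.2.1) / 2 = p.1 := by ring
    rw [a3]
    field_simp
    ring
  · have : 0 ≤ p.1 ^ 2 - p.2.1 ^ 2 := by nlinarith
    positivity

theorem integrableOn_spheroid (hd : 0 < d) (t : ℝ) (hk : Measurable k) (hq : Measurable q)
    (hint : Integrable (fun p => q p.1 * k (spheroidal b c d p))
      ((volume.restrict (Set.Ioc d t)).prod (sectionMeasure d))) :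
    IntegrableOn (fun z => q (‖z - (c - (d / 2) • b 0)‖ + ‖z - (c + (d / 2) • b 0)‖) /
        (‖z - (c - (d / 2) • b 0)‖ * ‖z - (c + (d / 2) • b 0)‖) * k z)
      (spheroid (c - (d / 2) • b 0) (c + (d / 2) • b 0) t) := by
  have hsm : Measurable (spheroidal b c d) := (continuous_spheroidal b c).measurable
  rw [IntegrableOn, volume_restrict_spheroid b c hd,
    integrable_map_measure (Measurable.aestronglyMeasurable (by fun_prop)) hsm.aemeasurable,
    integrable_withDensity_iff_integrable_smul' (by fun_prop) (by simp)]
  exact (integrable_congr (ae_jacobian_mul_eq b c hd t)).2 (hint.const_mul _)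

theorem setIntegral_spheroid (hd : 0 < d) (t : ℝ) (hk : Measurable k) (hq : Measurable q)
    (hint : Integrable (fun p => q p.1 * k (spheroidal b c d p))
      ((volume.restrict (Set.Ioc d t)).prod (sectionMeasure d))) :
    ∫ z in spheroid (c - (d / 2) • b 0) (c + (d / 2) • b 0) t,
        q (‖z - (c - (d / 2) • b 0)‖ + ‖z - (c + (d / 2) • b 0)‖) /
          (‖z - (c - (d / 2) • b 0)‖ * ‖z - (c + (d / 2) • b 0)‖) * k z =
      1 / (2 * d) * ∫ τ in Set.Ioc d t,
        q τ * ∫ s, k (spheroidal b c d (τ, s)) ∂(sectionMeasure d) := by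
  have hsm : Measurable (spheroidal b c d) := (continuous_spheroidal b c).measurable
  rw [volume_restrict_spheroid b c hd,
    integral_map hsm.aemeasurable (Measurable.aestronglyMeasurable (by fun_prop)),
    integral_withDensity_eq_integral_toReal_smul (by fun_prop) (by simp),
    integral_congr_ae (ae_jacobian_mul_eq b c hd t), integral_const_mul, integral_prod _ hint]
  simp only [integral_const_mul]

end SpheroidIntegral

/-! ### Differentiating integrals with polynomial kernels in `t - τ`. -/

section VolterraIntegrals

variable {h : ℝ → ℝ} {d t : ℝ}

/-- Expanding the power of `t - τ` moves `t` outside, leaving primitives of `τ ^ n * h τ`. At `d`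
itself `h` may be singular; only integrability is used there. -/
theorem hasDerivAt_integral_sub_mul (hi : ∀ t, d ≤ t → IntervalIntegrable h volume d t)
    (hc : ∀ t, d < t → ContinuousAt h t) (ht : d < t) :
    HasDerivAt (fun t => ∫ τ in d..t, h τ) (h t) t ∧
    HasDerivAt (fun t => ∫ τ in d..t, (t - τ) * h τ) (∫ τ in d..t, h τ) t ∧
    HasDerivAt (fun t => ∫ τ in d..t, (t - τ) ^ 2 * h τ) (2 * ∫ τ in d..t, (t - τ) * h τ) t := by
  have hi1 : ∀ t, d ≤ t → IntervalIntegrable (fun τ => τ * h τ) volume d t := fun t ht =>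
    (hi t ht).continuousOn_mul continuousOn_id
  have hi2 : ∀ t, d ≤ t → IntervalIntegrable (fun τ => τ ^ 2 * h τ) volume d t := fun t ht =>
    (hi t ht).continuousOn_mul (by fun_prop)
  have meas : ∀ g : ℝ → ℝ, (∀ t, d < t → ContinuousAt g t) →
      StronglyMeasurableAtFilter g (𝓝 t) := fun g hg =>
    ContinuousAt.stronglyMeasurableAtFilter isOpen_Ioi (fun x hx => hg x hx) t ht
  have hc1 : ∀ t, d < t → ContinuousAt (fun τ => τ * h τ) t := fun t ht =>
    continuousAt_id.mul (hc t ht)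
  have hc2 : ∀ t, d < t → ContinuousAt (fun τ => τ ^ 2 * h τ) t := fun t ht =>
    (continuousAt_id.pow 2).mul (hc t ht)
  have d0 := intervalIntegral.integral_hasDerivAt_right (hi t ht.le) (meas h hc) (hc t ht)
  have d1 := intervalIntegral.integral_hasDerivAt_right (hi1 t ht.le) (meas _ hc1) (hc1 t ht)
  have d2 := intervalIntegral.integral_hasDerivAt_right (hi2 t ht.le) (meas _ hc2) (hc2 t ht)
  have e1 : ∀ t, d ≤ t → ∫ τ in d..t, (t - τ) * h τ = t * (∫ τ in d..t, h τ) - ∫ τ in d..t, τ * h τ := by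
    intro t ht
    rw [← intervalIntegral.integral_const_mul, ← intervalIntegral.integral_sub
      ((hi t ht).const_mul t) (hi1 t ht)]
    congr 1; ext τ; ring
  have e2 : ∀ t, d ≤ t → ∫ τ in d..t, (t - τ) ^ 2 * h τ =
      t ^ 2 * (∫ τ in d..t, h τ) - 2 * t * (∫ τ in d..t, τ * h τ) + ∫ τ in d..t, τ ^ 2 * h τ := by
    intro t ht
    rw [← intervalIntegral.integral_const_mul, ← intervalIntegral.integral_const_mul,
      ← intervalIntegral.integral_sub ((hi t ht).const_mul _) ((hi1 t ht).const_mul _),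
      ← intervalIntegral.integral_add (((hi t ht).const_mul _).sub ((hi1 t ht).const_mul _)) (hi2 t ht)]
    congr 1; ext τ; ring
  refine ⟨d0, ?_, ?_⟩
  · refine ((((hasDerivAt_id t).mul d0).sub d1).congr_deriv ?_).congr_of_eventuallyEq
      ((eventually_ge_nhds ht).mono e1)
    simp
  · refine ((((((hasDerivAt_id t).pow 2).mul d0).sub
      (((hasDerivAt_id t).const_mul 2).mul d1)).add d2).congr_deriv ?_).congr_of_eventuallyEq
      ((eventually_ge_nhds ht).mono e2)
    rw [e1 t ht.le]
    simp
    ring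

theorem tendsto_integral_nhdsGT (hi : ∀ t, d ≤ t → IntervalIntegrable h volume d t) :
    Tendsto (fun t => ∫ τ in d..t, h τ) (𝓝[>] d) (𝓝 0) := by
  have h1 : d ≤ d + 1 := by linarith
  have hc := intervalIntegral.continuousOn_primitive_interval (f := h) (a := d) (b := d + 1)
    (μ := volume) (by
      rw [Set.uIcc_of_le h1, integrableOn_Icc_iff_integrableOn_Ioc,
        ← intervalIntegrable_iff_integrableOn_Ioc_of_le h1]
      exact hi _ h1)
  rw [Set.uIcc_of_le h1] at hc
  have := (hc d ⟨le_rfl, h1⟩).tendsto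
  rw [intervalIntegral.integral_same] at this
  exact this.mono_left (nhdsWithin_le_of_mem
    (mem_of_superset (Ioc_mem_nhdsGT (by linarith)) Set.Ioc_subset_Icc_self))

end VolterraIntegrals

/-! ### Parameter integrals over `(σ, φ)`. -/

section SectionIntegrals

/-- The closed range of the coordinates `(σ, φ)`. -/
def sectionBox (d : ℝ) : Set (ℝ × ℝ) := Set.Icc (-d) d ×ˢ Set.Icc (-Real.pi) Real.pi

variable {d τ₀ : ℝ} {T : Set ℝ} {F F' : ℝ → ℝ × ℝ → ℝ}

theorem isCompact_sectionBox (d : ℝ) : IsCompact (sectionBox d) := isCompact_Icc.prod isCompact_Icc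

theorem ae_mem_sectionBox : ∀ᵐ s ∂(sectionMeasure d), s ∈ sectionBox d := by
  filter_upwards [ae_sectionMeasure] with s hs
  exact ⟨Set.Ioo_subset_Icc_self hs.1, Set.Ioo_subset_Icc_self hs.2⟩

theorem sectionMeasure_restrict_box : (sectionMeasure d).restrict (sectionBox d) =
    sectionMeasure d :=
  Measure.restrict_eq_self_of_ae_mem ae_mem_sectionBox

/-- Supplies the constant dominating functions for continuity and differentiation under the
integral; the box is taken closed so that it is compact. -/
theorem exists_bound_of_continuousOn_box (hT : IsOpen T) (h₀ : τ₀ ∈ T)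
    (hF : ContinuousOn (Function.uncurry F) (T ×ˢ sectionBox d)) :
    ∃ U ∈ 𝓝 τ₀, U ⊆ T ∧ ∃ C, ∀ τ ∈ U, ∀ s ∈ sectionBox d, ‖F τ s‖ ≤ C := by
  obtain ⟨U, hU, hUT, hUc⟩ := local_compact_nhds (hT.mem_nhds h₀)
  obtain ⟨C, hC⟩ := (hUc.prod (isCompact_sectionBox d)).exists_bound_of_continuousOn
    (hF.mono (Set.prod_mono hUT subset_rfl))
  exact ⟨U, hU, hUT, C, fun τ hτ s hs => hC (τ, s) ⟨hτ, hs⟩⟩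

theorem continuousOn_box_apply (hF : ContinuousOn (Function.uncurry F) (T ×ˢ sectionBox d))
    {τ : ℝ} (hτ : τ ∈ T) : ContinuousOn (F τ) (sectionBox d) :=
  hF.comp (f := fun s => (τ, s)) (by fun_prop) fun _ hs => ⟨hτ, hs⟩

theorem aestronglyMeasurable_box (hF : ContinuousOn (Function.uncurry F) (T ×ˢ sectionBox d))
    {τ : ℝ} (hτ : τ ∈ T) : AEStronglyMeasurable (F τ) (sectionMeasure d) := by
  rw [← sectionMeasure_restrict_box]
  exact (continuousOn_box_apply hF hτ).aestronglyMeasurable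
    (isCompact_sectionBox d).isClosed.measurableSet

theorem integrable_box (hF : ContinuousOn (Function.uncurry F) (T ×ˢ sectionBox d))
    {τ : ℝ} (hτ : τ ∈ T) : Integrable (F τ) (sectionMeasure d) := by
  rw [← sectionMeasure_restrict_box]
  exact (continuousOn_box_apply hF hτ).integrableOn_compact (isCompact_sectionBox d)

theorem continuousAt_integral_section (hT : IsOpen T) (h₀ : τ₀ ∈ T)
    (hF : ContinuousOn (Function.uncurry F) (T ×ˢ sectionBox d)) :
    ContinuousAt (fun τ => ∫ s, F τ s ∂(sectionMeasure d)) τ₀ := by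
  obtain ⟨U, hU, hUT, C, hC⟩ := exists_bound_of_continuousOn_box hT h₀ hF
  refine continuousAt_of_dominated (bound := fun _ => C) ?_ ?_ (integrable_const C) ?_
  · filter_upwards [hU] with τ hτ using aestronglyMeasurable_box hF (hUT hτ)
  · filter_upwards [hU] with τ hτ
    filter_upwards [ae_mem_sectionBox] with s hs using hC τ hτ s hs
  · filter_upwards [ae_mem_sectionBox] with s hs
    have : ContinuousOn (fun τ => F τ s) T :=
      hF.comp (f := fun τ => (τ, s)) (by fun_prop) fun τ hτ => ⟨hτ, hs⟩
    exact this.continuousAt (hT.mem_nhds h₀)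

theorem hasDerivAt_integral_section (hT : IsOpen T) (h₀ : τ₀ ∈ T)
    (hF : ContinuousOn (Function.uncurry F) (T ×ˢ sectionBox d))
    (hF' : ContinuousOn (Function.uncurry F') (T ×ˢ sectionBox d))
    (hd : ∀ τ ∈ T, ∀ s ∈ sectionBox d, HasDerivAt (fun τ => F τ s) (F' τ s) τ) :
    HasDerivAt (fun τ => ∫ s, F τ s ∂(sectionMeasure d)) (∫ s, F' τ₀ s ∂(sectionMeasure d)) τ₀ := by
  obtain ⟨U, hU, hUT, C, hC⟩ := exists_bound_of_continuousOn_box hT h₀ hF'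
  refine (hasDerivAt_integral_of_dominated_loc_of_deriv_le (bound := fun _ => C) hU ?_
    (integrable_box hF h₀) (aestronglyMeasurable_box hF' h₀) ?_ (integrable_const C) ?_).2
  · filter_upwards [hU] with τ hτ using aestronglyMeasurable_box hF (hUT hτ)
  · filter_upwards [ae_mem_sectionBox] with s hs τ hτ using hC τ hτ s hs
  · filter_upwards [ae_mem_sectionBox] with s hs τ hτ using hd τ (hUT hτ) s hs

/-- Iterated form of an integral over the coordinates `(σ, φ)`. -/
theorem integral_sectionMeasure (hd : 0 ≤ d) {f : ℝ × ℝ → ℝ} (hf : Continuous f) :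
    ∫ s, f s ∂(sectionMeasure d) =
      ∫ σ in (-d)..d, ∫ φ in (-Real.pi)..Real.pi, f (σ, φ) := by
  have hi : Integrable f (sectionMeasure d) :=
    integrable_box (F := fun _ => f) (T := Set.univ) (τ := 0)
      (hf.comp continuous_snd).continuousOn trivial
  have hπ := Real.pi_pos
  unfold sectionMeasure at hi ⊢
  rw [integral_prod _ hi, intervalIntegral.integral_of_le (by linarith),
    integral_Ioc_eq_integral_Ioo]
  congr 1
  ext σ
  rw [intervalIntegral.integral_of_le (by linarith), integral_Ioc_eq_integral_Ioo]

end SectionIntegrals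

/-! ### The radial derivative of `ρ`. -/

section RadialGradient

variable {ρ : E3 → ℝ}

theorem continuous_gradient (hρ : ContDiff ℝ 1 ρ) : Continuous (gradient ρ) := by
  unfold gradient
  exact (LinearIsometryEquiv.continuous _).comp (hρ.continuous_fderiv one_ne_zero)

theorem measurable_radialGrad (hρ : ContDiff ℝ 1 ρ) (y : E3) : Measurable (radialGrad ρ y) := by
  have := (continuous_gradient hρ).measurable
  unfold radialGrad
  fun_prop

/-- Valid at `z = y` too, where the normalised vector is `0`. -/
theorem abs_radialGrad_le (ρ : E3 → ℝ) (y z : E3) : |radialGrad ρ y z| ≤ ‖gradient ρ z‖ := by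
  refine (abs_real_inner_le_norm _ _).trans (mul_le_of_le_one_right (norm_nonneg _) ?_)
  rw [norm_smul, norm_inv, norm_norm]
  exact inv_mul_le_one

theorem continuousOn_radialGrad (hρ : ContDiff ℝ 1 ρ) (y : E3) :
    ContinuousOn (radialGrad ρ y) {y}ᶜ := by
  have := continuous_gradient hρ
  have h : ContinuousOn (fun z : E3 => ‖z - y‖⁻¹) {y}ᶜ :=
    ContinuousOn.inv₀ (by fun_prop) fun z hz => norm_ne_zero_iff.2 (sub_ne_zero.2 hz)
  unfold radialGrad
  exact this.continuousOn.inner (h.smul (by fun_prop))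

/-- The density of the second `ρ`-term, without its polynomial weight. -/
noncomputable def radialGradDiv (ρ : E3 → ℝ) (y z : E3) : ℝ := radialGrad ρ y z / ‖z - y‖

theorem measurable_radialGradDiv (hρ : ContDiff ℝ 1 ρ) (y : E3) :
    Measurable (radialGradDiv ρ y) :=
  (measurable_radialGrad hρ y).div (by fun_prop)

theorem continuousOn_radialGradDiv (hρ : ContDiff ℝ 1 ρ) (y : E3) :
    ContinuousOn (radialGradDiv ρ y) {y}ᶜ :=
  (continuousOn_radialGrad hρ y).div (by fun_prop)
    fun _ hz => norm_ne_zero_iff.2 (sub_ne_zero.2 hz)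

end RadialGradient

/-! ### Section integrals: integrability and the limit of the `ρ`-term. -/

section Sections

variable (b : OrthonormalBasis (Fin 3) ℝ E3) (c : E3) {d : ℝ} {k : E3 → ℝ} {ρ : E3 → ℝ}

/-- The integral of a function over the spheroid with parameter `τ`, in the coordinates
`(σ, φ)`. -/
noncomputable def sectionIntegral (d : ℝ) (k : E3 → ℝ) (τ : ℝ) : ℝ :=
  ∫ s, k (spheroidal b c d (τ, s)) ∂(sectionMeasure d)

theorem spheroidal_ne_focus (hd : 0 < d) {p : ℝ × ℝ × ℝ} (h₁ : d ≤ p.1)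
    (h₂ : p.2.1 ∈ Set.Icc (-d) d) (h₃ : p.2.1 < p.1) :
    spheroidal b c d p ≠ c + (d / 2) • b 0 := by
  have := (norm_spheroidal_sub b c hd h₁ h₂).2
  intro h
  rw [h, sub_self, norm_zero] at this
  linarith

theorem continuousOn_spheroidal_box (hd : 0 < d) (hk : ContinuousOn k {c + (d / 2) • b 0}ᶜ) :
    ContinuousOn (Function.uncurry fun τ s => k (spheroidal b c d (τ, s)))
      (Set.Ioi d ×ˢ sectionBox d) := by
  refine hk.comp (f := spheroidal b c d) (continuous_spheroidal b c).continuousOn ?_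
  rintro p ⟨h1, h2, -⟩
  exact spheroidal_ne_focus b c hd (le_of_lt h1) h2 (h2.2.trans_lt h1)

theorem continuousAt_sectionIntegral (hd : 0 < d) (hk : ContinuousOn k {c + (d / 2) • b 0}ᶜ)
    {t : ℝ} (ht : d < t) : ContinuousAt (sectionIntegral b c d k) t :=
  continuousAt_integral_section isOpen_Ioi ht (continuousOn_spheroidal_box b c hd hk)

theorem intervalIntegrable_sectionIntegral
    (hi : ∀ t, Integrable (fun p => k (spheroidal b c d p))
      ((volume.restrict (Set.Ioc d t)).prod (sectionMeasure d))) {t : ℝ} (ht : d ≤ t) :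
    IntervalIntegrable (sectionIntegral b c d k) volume d t := by
  rw [intervalIntegrable_iff_integrableOn_Ioc_of_le ht]
  exact (hi t).integral_prod_left

theorem integrable_mul_spheroidal {q : ℝ → ℝ} (hq : Continuous q) {t : ℝ}
    (hi : Integrable (fun p => k (spheroidal b c d p))
      ((volume.restrict (Set.Ioc d t)).prod (sectionMeasure d))) :
    Integrable (fun p => q p.1 * k (spheroidal b c d p))
      ((volume.restrict (Set.Ioc d t)).prod (sectionMeasure d)) := by
  obtain ⟨C, hC⟩ := isCompact_Icc.exists_bound_of_continuousOn (hq.continuousOn (s := Set.Icc d t))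
  refine hi.bdd_mul (c := C) (by fun_prop) ?_
  filter_upwards [ae_prod_sectionMeasure (d := d) measurableSet_Ioc] with p hp
  exact hC _ (Set.Ioc_subset_Icc_self hp.1)

theorem exists_bound_gradient_spheroidal (hρ : ContDiff ℝ 1 ρ) (t : ℝ) :
    ∃ M, ∀ p ∈ Set.Icc d t ×ˢ sectionBox d, ∀ y, |radialGrad ρ y (spheroidal b c d p)| ≤ M := by
  obtain ⟨M, hM⟩ := (isCompact_Icc.prod (isCompact_sectionBox d)).exists_bound_of_continuousOn
    (((continuous_gradient hρ).comp (continuous_spheroidal b c)).continuousOn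
      (s := Set.Icc d t ×ˢ sectionBox d))
  exact ⟨M, fun p hp y => (abs_radialGrad_le _ _ _).trans (hM p hp)⟩

theorem mem_box_of_ae {t : ℝ} : ∀ᵐ p ∂((volume.restrict (Set.Ioc d t)).prod (sectionMeasure d)),
    p ∈ Set.Icc d t ×ˢ sectionBox d := by
  filter_upwards [ae_prod_sectionMeasure (d := d) measurableSet_Ioc] with p hp
  exact ⟨Set.Ioc_subset_Icc_self hp.1, Set.Ioo_subset_Icc_self hp.2.1,
    Set.Ioo_subset_Icc_self hp.2.2⟩

theorem integrable_continuous_spheroidal (hk : Continuous k) (t : ℝ) :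
    Integrable (fun p => k (spheroidal b c d p))
      ((volume.restrict (Set.Ioc d t)).prod (sectionMeasure d)) := by
  have hc : Continuous fun p => k (spheroidal b c d p) := hk.comp (continuous_spheroidal b c)
  obtain ⟨M, hM⟩ := (isCompact_Icc.prod (isCompact_sectionBox d)).exists_bound_of_continuousOn
    (hc.continuousOn (s := Set.Icc d t ×ˢ sectionBox d))
  exact Integrable.of_bound hc.aestronglyMeasurable M (mem_box_of_ae.mono hM)

theorem integrable_radialGrad_spheroidal (hρ : ContDiff ℝ 1 ρ) (y : E3) (t : ℝ) :
    Integrable (fun p => radialGrad ρ y (spheroidal b c d p))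
      ((volume.restrict (Set.Ioc d t)).prod (sectionMeasure d)) := by
  obtain ⟨M, hM⟩ := exists_bound_gradient_spheroidal b c (d := d) hρ t
  exact Integrable.of_bound ((measurable_radialGrad hρ y).comp
    (continuous_spheroidal b c).measurable).aestronglyMeasurable M
    (mem_box_of_ae.mono fun p hp => hM p hp y)

theorem integrable_rpow_sectionMeasure (d : ℝ) :
    Integrable (fun s : ℝ × ℝ => (d - s.1) ^ (-(1 / 2) : ℝ)) (sectionMeasure d) := by
  have h : IntegrableOn (fun σ : ℝ => (d - σ) ^ (-(1 / 2) : ℝ)) (Set.Ioo (-d) d) := by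
    have := (intervalIntegral.intervalIntegrable_rpow' (a := 0) (b := 2 * d)
      (r := -(1 / 2)) (by norm_num)).comp_sub_left d
    have h2 := this.symm
    rw [intervalIntegrable_iff] at h2
    refine h2.mono_set ?_
    intro σ hσ
    have h3 := hσ.1.trans hσ.2
    rw [Set.uIoc_of_le (by linarith)]
    constructor <;> linarith [hσ.1, hσ.2]
  have := Integrable.mul_prod h (integrable_const (μ := volume.restrict
    (Set.Ioo (-Real.pi) Real.pi)) (1 : ℝ))
  simpa [sectionMeasure] using this

/-- The singularity `2/(τ - σ)` at the focus is dominated by a product of inverse square roots in `τ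
- d` and `d - σ`, each integrable. -/
theorem integrable_radialGradDiv_spheroidal (hd : 0 < d) (hρ : ContDiff ℝ 1 ρ) (t : ℝ) :
    Integrable (fun p => radialGradDiv ρ (c + (d / 2) • b 0) (spheroidal b c d p))
      ((volume.restrict (Set.Ioc d t)).prod (sectionMeasure d)) := by
  obtain ⟨M, hM⟩ := exists_bound_gradient_spheroidal b c (d := d) hρ t
  have hsm : Measurable (spheroidal b c d) := (continuous_spheroidal b c).measurable
  have h1 : IntegrableOn (fun τ : ℝ => (τ - d) ^ (-(1 / 2) : ℝ)) (Set.Ioc d t) := by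
    have := (intervalIntegral.intervalIntegrable_rpow' (a := 0) (b := t - d)
      (r := -(1 / 2)) (by norm_num)).comp_sub_right d
    rw [intervalIntegrable_iff] at this
    refine this.mono_set ?_
    rw [zero_add, sub_add_cancel]
    exact Set.Ioc_subset_uIoc
  have h2 := (Integrable.mul_prod h1 (integrable_rpow_sectionMeasure d)).const_mul M
  refine h2.mono' ((measurable_radialGradDiv hρ _).comp hsm).aestronglyMeasurable ?_
  filter_upwards [ae_prod_sectionMeasure (d := d) measurableSet_Ioc, mem_box_of_ae] with p hp hp'
  obtain ⟨⟨a1, a2⟩, ⟨a3, a4⟩, -⟩ := hp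
  rw [radialGradDiv, (norm_spheroidal_sub b c hd a1.le ⟨a3.le, a4.le⟩).2, norm_div, Real.norm_eq_abs]
  have hMp := hM p hp' (c + (d / 2) • b 0)
  have u : 0 < p.1 - d := by linarith
  have v : 0 < d - p.2.1 := by linarith
  rw [Real.rpow_neg u.le, Real.rpow_neg v.le, ← Real.sqrt_eq_rpow, ← Real.sqrt_eq_rpow,
    ← mul_inv, ← div_eq_mul_inv]
  have su := Real.sqrt_pos.2 u
  have sv := Real.sqrt_pos.2 v
  have qu := Real.sq_sqrt u.le
  have qv := Real.sq_sqrt v.le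
  -- Arithmetic-geometric mean inequality for `τ - d` and `d - σ`, whose sum is `τ - σ`.
  have hle : √(p.1 - d) * √(d - p.2.1) ≤ ‖(p.1 - p.2.1) / 2‖ := by
    rw [Real.norm_of_nonneg (by linarith)]
    nlinarith [sq_nonneg (√(p.1 - d) - √(d - p.2.1))]
  exact div_le_div₀ ((abs_nonneg _).trans hMp) hMp (by positivity) hle

theorem spheroidal_focal (hd : 0 < d) (s : ℝ × ℝ) :
    spheroidal b c d (d, s) = c + (s.1 / 2) • b 0 := by
  have : d * s.1 / (2 * d) = s.1 / 2 := by field_simp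
  simp [spheroidal, axialRadial, this]

/-- On the segment, `z - y` points opposite to the axis vector `b 0`. -/
theorem radialGrad_focal (ρ : E3 → ℝ) {σ : ℝ} (hσ : σ < d) :
    radialGrad ρ (c + (d / 2) • b 0) (c + (σ / 2) • b 0) =
      -fderiv ℝ ρ (c + (σ / 2) • b 0) (b 0) := by
  have e : c + (σ / 2) • b 0 - (c + (d / 2) • b 0) = ((σ - d) / 2) • b 0 := by module
  have h : (σ - d) / 2 < 0 := by linarith
  rw [radialGrad, e, norm_smul, b.norm_eq_one, mul_one, Real.norm_of_nonpos h.le, smul_smul,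
    inner_smul_right, gradient, InnerProductSpace.toDual_symm_apply]
  have h' : σ - d ≠ 0 := (sub_neg.2 hσ).ne
  field_simp

theorem integral_fderiv_axis (hρ : ContDiff ℝ 1 ρ) :
    ∫ σ in (-d)..d, fderiv ℝ ρ (c + (σ / 2) • b 0) (b 0) =
      2 * (ρ (c + (d / 2) • b 0) - ρ (c - (d / 2) • b 0)) := by
  have hf := hρ.continuous_fderiv one_ne_zero
  have hder : ∀ σ : ℝ, HasDerivAt (fun σ : ℝ => 2 * ρ (c + (σ / 2) • b 0))
      (fderiv ℝ ρ (c + (σ / 2) • b 0) (b 0)) σ := by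
    intro σ
    have h1 : HasDerivAt (fun σ : ℝ => c + (σ / 2) • b 0) ((1 / 2 : ℝ) • b 0) σ :=
      (((hasDerivAt_id σ).div_const 2).smul_const (b 0)).const_add c
    have h2 := ((hρ.differentiable one_ne_zero _).hasFDerivAt.comp_hasDerivAt σ h1).const_mul 2
    refine h2.congr_deriv ?_
    rw [map_smul, smul_eq_mul]; ring
  rw [intervalIntegral.integral_eq_sub_of_hasDerivAt (fun σ _ => hder σ)
    (Continuous.intervalIntegrable (by fun_prop) _ _)]
  rw [neg_div, neg_smul, ← sub_eq_add_neg]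
  ring

/-- The radial direction is discontinuous at `y`, which the limit segment reaches only at `σ = d`, a
null set. Dominated convergence therefore applies, and the limit is a total derivative along the
axis. -/
theorem tendsto_sectionIntegral_radialGrad (hd : 0 < d) (hρ : ContDiff ℝ 1 ρ) :
    Tendsto (sectionIntegral b c d (radialGrad ρ (c + (d / 2) • b 0))) (𝓝[>] d)
      (𝓝 (4 * Real.pi * (ρ (c - (d / 2) • b 0) - ρ (c + (d / 2) • b 0)))) := by
  set y := c + (d / 2) • b 0 with hy
  have hval : ∫ s, radialGrad ρ y (spheroidal b c d (d, s)) ∂(sectionMeasure d) =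
      4 * Real.pi * (ρ (c - (d / 2) • b 0) - ρ y) := by
    have h1 : ∫ s, radialGrad ρ y (spheroidal b c d (d, s)) ∂(sectionMeasure d) =
        ∫ s, -fderiv ℝ ρ (c + (s.1 / 2) • b 0) (b 0) ∂(sectionMeasure d) := by
      refine integral_congr_ae ?_
      filter_upwards [ae_sectionMeasure] with s hs
      rw [spheroidal_focal b c hd, hy, radialGrad_focal b c ρ hs.1.2]
    have hf := hρ.continuous_fderiv one_ne_zero
    rw [h1, integral_sectionMeasure hd.le (by fun_prop)]
    simp only [intervalIntegral.integral_const, intervalIntegral.integral_neg,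
      intervalIntegral.integral_smul, integral_fderiv_axis b c hρ]
    rw [smul_eq_mul]
    ring
  rw [← hval]
  have hsm : Measurable (spheroidal b c d) := (continuous_spheroidal b c).measurable
  obtain ⟨M, hM⟩ := exists_bound_gradient_spheroidal b c (d := d) hρ (d + 1)
  have hnear : ∀ᶠ τ in 𝓝[>] d, τ ∈ Set.Ioc d (d + 1) := Ioc_mem_nhdsGT (by linarith)
  refine tendsto_integral_filter_of_dominated_convergence (fun _ => M) ?_ ?_ (integrable_const M) ?_
  · refine Eventually.of_forall fun τ => ?_
    exact ((measurable_radialGrad hρ y).comp (hsm.comp measurable_prodMk_left)).aestronglyMeasurable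
  · filter_upwards [hnear] with τ hτ
    filter_upwards [ae_mem_sectionBox] with s hs
    exact hM (τ, s) ⟨Set.Ioc_subset_Icc_self hτ, hs⟩ y
  · filter_upwards [ae_sectionMeasure] with s hs
    have hne : spheroidal b c d (d, s) ≠ y :=
      spheroidal_ne_focus b c hd le_rfl (Set.Ioo_subset_Icc_self hs.1) hs.1.2
    have hcont : ContinuousAt (fun τ => radialGrad ρ y (spheroidal b c d (τ, s))) d := by
      refine ContinuousAt.comp (f := fun τ => spheroidal b c d (τ, s))
        ((continuousOn_radialGrad hρ y).continuousAt (isOpen_compl_singleton.mem_nhds hne)) ?_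
      exact ((continuous_spheroidal b c).comp (Continuous.prodMk_left s)).continuousAt
    exact hcont.tendsto.mono_left nhdsWithin_le_nhds

end Sections

/-! ### Derivative of the `α`-section integral by symmetrisation. -/

section Symmetrised

variable (b : OrthonormalBasis (Fin 3) ℝ E3) (c : E3) {d : ℝ} {α : E3 → ℝ}

/-- The unit vector orthogonal to the axis `b 0` at azimuth `φ`. -/
noncomputable def azimuth (φ : ℝ) : E3 := Real.cos φ • b 1 + Real.sin φ • b 2

/-- The points of the line through the spheroidal point `(τ, σ, φ)` (at `u = 1`) that is
orthogonal to the axis (met at `u = 0`). -/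
noncomputable def transversal (d τ : ℝ) (s : ℝ × ℝ) (u : ℝ) : E3 :=
  c + (τ * s.1 / (2 * d)) • b 0 + (u * (axialRadial d (τ, s.1)).2) • azimuth b s.2

/-- The second derivative of `α` at `z` in the direction `v`, twice. -/
noncomputable def hessian (α : E3 → ℝ) (z v : E3) : ℝ := fderiv ℝ (fderiv ℝ α) z v v

/-- The mean of `α` at a spheroidal point and at its reflection in the axis. -/
noncomputable def symMean (α : E3 → ℝ) (d τ : ℝ) (s : ℝ × ℝ) : ℝ :=
  (α (transversal b c d τ s 1) + α (transversal b c d τ s (-1))) / 2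

/-- The derivative of `symMean` in `τ`, in a form that is continuous up to the focal segment. -/
noncomputable def symMeanDeriv (α : E3 → ℝ) (d τ : ℝ) (s : ℝ × ℝ) : ℝ :=
  (fderiv ℝ α (transversal b c d τ s 1) (b 0) + fderiv ℝ α (transversal b c d τ s (-1)) (b 0)) / 2 *
      (s.1 / (2 * d)) +
    τ * (d ^ 2 - s.1 ^ 2) / (8 * d ^ 2) *
      ∫ u in (-1 : ℝ)..1, hessian α (transversal b c d τ s u) (azimuth b s.2)

theorem continuous_azimuth : Continuous (azimuth b) := by
  unfold azimuth; fun_prop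

theorem continuous_transversal :
    Continuous fun p : (ℝ × ℝ × ℝ) × ℝ => transversal b c d p.1.1 p.1.2 p.2 := by
  unfold transversal axialRadial azimuth; fun_prop

theorem continuous_transversal_left (u : ℝ) :
    Continuous fun p : ℝ × ℝ × ℝ => transversal b c d p.1 p.2 u := by
  unfold transversal axialRadial azimuth; fun_prop

theorem continuous_transversal_section (τ u : ℝ) :
    Continuous fun s : ℝ × ℝ => transversal b c d τ s u := by
  unfold transversal axialRadial azimuth; fun_prop

theorem contDiff_fderiv (hα : ContDiff ℝ 2 α) : ContDiff ℝ 1 (fderiv ℝ α) :=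
  hα.fderiv_right (by norm_num)

theorem continuous_fderiv_fderiv (hα : ContDiff ℝ 2 α) : Continuous (fderiv ℝ (fderiv ℝ α)) :=
  (contDiff_fderiv hα).continuous_fderiv one_ne_zero

theorem continuous_symMean (hα : Continuous α) :
    Continuous (Function.uncurry (symMean b c α d)) := by
  have h1 := continuous_transversal_left b c (d := d) 1
  have h2 := continuous_transversal_left b c (d := d) (-1)
  unfold symMean Function.uncurry
  fun_prop

theorem continuous_symMeanDeriv (hα : ContDiff ℝ 2 α) :
    Continuous (Function.uncurry (symMeanDeriv b c α d)) := by
  have h1 := continuous_transversal_left b c (d := d) 1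
  have h2 := continuous_transversal_left b c (d := d) (-1)
  have h3 := (contDiff_fderiv hα).continuous
  have h4 := continuous_fderiv_fderiv hα
  have h5 : Continuous fun p : ℝ × ℝ × ℝ =>
      ∫ u in (-1 : ℝ)..1, hessian α (transversal b c d p.1 p.2 u) (azimuth b p.2.2) := by
    refine intervalIntegral.continuous_parametric_intervalIntegral_of_continuous' ?_ _ _
    have h6 := continuous_transversal b c (d := d)
    have h7 := continuous_azimuth b
    unfold hessian Function.uncurry
    fun_prop
  unfold symMeanDeriv Function.uncurry
  fun_prop

/-- The fundamental theorem of calculus along the chord produces the factor `r` that compensates the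
singular derivative of the radius. -/
theorem fderiv_sub_eq_integral_hessian (hα : ContDiff ℝ 2 α) (p v : E3) (r : ℝ) :
    fderiv ℝ α (p + r • v) v - fderiv ℝ α (p + (-r) • v) v =
      r * ∫ u in (-1 : ℝ)..1, hessian α (p + (u * r) • v) v := by
  have h4 := continuous_fderiv_fderiv hα
  have hder : ∀ u : ℝ, HasDerivAt (fun u : ℝ => fderiv ℝ α (p + (u * r) • v) v)
      (r * hessian α (p + (u * r) • v) v) u := by
    intro u
    have h1 : HasDerivAt (fun u : ℝ => p + (u * r) • v) ((1 * r) • v) u :=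
      (((hasDerivAt_id u).mul_const r).smul_const v).const_add p
    have h2 := ((contDiff_fderiv hα).differentiable one_ne_zero _).hasFDerivAt.comp_hasDerivAt u h1
    have h3 := h2.clm_apply (hasDerivAt_const u v)
    refine h3.congr_deriv ?_
    simp [hessian]
  rw [← intervalIntegral.integral_const_mul,
    intervalIntegral.integral_eq_sub_of_hasDerivAt (fun u _ => hder u)
      (Continuous.intervalIntegrable (by unfold hessian; fun_prop) _ _)]
  simp

theorem hasDerivAt_symMean (hd : 0 < d) (hα : ContDiff ℝ 2 α) {τ : ℝ} (hτ : d < τ) {s : ℝ × ℝ}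
    (hs : s.1 ∈ Set.Icc (-d) d) :
    HasDerivAt (fun τ => symMean b c α d τ s) (symMeanDeriv b c α d τ s) τ := by
  have a1 : 0 < τ ^ 2 - d ^ 2 := by nlinarith
  have a2 : 0 ≤ d ^ 2 - s.1 ^ 2 := by nlinarith [hs.1, hs.2]
  have s1 := Real.sqrt_pos.2 a1
  have q2 := Real.sq_sqrt a2
  -- `R'` is the derivative of the radius and is unbounded as `τ` tends to `d`; `hRR` below shows
  -- that its product with the radius is not.
  set R' := τ * √(d ^ 2 - s.1 ^ 2) / (2 * d * √(τ ^ 2 - d ^ 2)) with hR'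
  have hR : HasDerivAt (fun τ => (axialRadial d (τ, s.1)).2) R' τ := by
    have := (((((hasDerivAt_id τ).pow 2).sub_const (d ^ 2)).sqrt a1.ne').mul_const
      (√(d ^ 2 - s.1 ^ 2))).div_const (2 * d)
    refine this.congr_deriv ?_
    simp only [hR', id, Pi.pow_apply]
    field_simp
    simp
  have ht : ∀ u, HasDerivAt (fun τ => transversal b c d τ s u)
      ((s.1 / (2 * d)) • b 0 + (u * R') • azimuth b s.2) τ := by
    intro u
    have h1 : HasDerivAt (fun τ : ℝ => τ * s.1 / (2 * d)) (1 * s.1 / (2 * d)) τ :=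
      ((hasDerivAt_id τ).mul_const s.1).div_const _
    rw [one_mul] at h1
    exact ((h1.smul_const (b 0)).const_add c).add ((hR.const_mul u).smul_const (azimuth b s.2))
  have hαd : ∀ u, HasDerivAt (fun τ => α (transversal b c d τ s u))
      (fderiv ℝ α (transversal b c d τ s u) ((s.1 / (2 * d)) • b 0 + (u * R') • azimuth b s.2)) τ :=
    fun u => (hα.differentiable two_ne_zero _).hasFDerivAt.comp_hasDerivAt τ (ht u)
  have key := fderiv_sub_eq_integral_hessian hα (c + (τ * s.1 / (2 * d)) • b 0) (azimuth b s.2)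
    (axialRadial d (τ, s.1)).2
  have hRR : R' * (axialRadial d (τ, s.1)).2 = τ * (d ^ 2 - s.1 ^ 2) / (4 * d ^ 2) := by
    simp only [hR', axialRadial]
    rw [← q2]
    field_simp
    simp only [q2]
    ring
  refine (((hαd 1).add (hαd (-1))).div_const 2).congr_deriv ?_
  rw [symMeanDeriv]
  have e1 : transversal b c d τ s 1 =
    c + (τ * s.1 / (2 * d)) • b 0 + (axialRadial d (τ, s.1)).2 • azimuth b s.2 := by
    rw [transversal, one_mul]
  have e2 : transversal b c d τ s (-1) =
    c + (τ * s.1 / (2 * d)) • b 0 + (-(axialRadial d (τ, s.1)).2) • azimuth b s.2 := by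
    rw [transversal, neg_one_mul]
  rw [← e1, ← e2] at key
  simp only [map_add, map_smul, smul_eq_mul]
  have e3 : ∀ u, c + (τ * s.1 / (2 * d)) • b 0 + (u * (axialRadial d (τ, s.1)).2) • azimuth b s.2 =
    transversal b c d τ s u := fun u => rfl
  simp only [e3] at key
  have e4 : τ * (d ^ 2 - s.1 ^ 2) / (8 * d ^ 2) = R' * (axialRadial d (τ, s.1)).2 / 2 := by
    rw [hRR]; ring
  rw [e4]
  linear_combination R' / 2 * key

/-- Reflection in the axis is the shift `φ ↦ φ + π`, which leaves the integral over a full period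
unchanged. -/
theorem integral_symMean (hd : 0 ≤ d) (hα : Continuous α) (τ : ℝ) :
    ∫ s, symMean b c α d τ s ∂(sectionMeasure d) = sectionIntegral b c d α τ := by
  have g1 : Continuous fun s => α (transversal b c d τ s 1) :=
    hα.comp (continuous_transversal_section b c τ 1)
  have g2 : Continuous fun s => α (transversal b c d τ s (-1)) :=
    hα.comp (continuous_transversal_section b c τ (-1))
  have e1 : ∀ s, α (transversal b c d τ s 1) = α (spheroidal b c d (τ, s)) := by
    intro s
    rw [transversal, one_mul]; rfl
  have i1 : Integrable (fun s => α (transversal b c d τ s 1)) (sectionMeasure d) :=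
    integrable_box (F := fun _ s => α (transversal b c d τ s 1)) (T := Set.univ) (τ := 0)
      (g1.comp continuous_snd).continuousOn trivial
  have i2 : Integrable (fun s => α (transversal b c d τ s (-1))) (sectionMeasure d) :=
    integrable_box (F := fun _ s => α (transversal b c d τ s (-1))) (T := Set.univ) (τ := 0)
      (g2.comp continuous_snd).continuousOn trivial
  have e2 : ∫ s, α (transversal b c d τ s (-1)) ∂(sectionMeasure d) =
      ∫ s, α (transversal b c d τ s 1) ∂(sectionMeasure d) := by
    rw [integral_sectionMeasure hd g1, integral_sectionMeasure hd g2]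
    congr 1
    ext σ
    set f : ℝ → ℝ := fun φ => α (transversal b c d τ (σ, φ) 1) with hf
    have hp : Function.Periodic f (2 * Real.pi) := by
      intro φ
      simp [hf, transversal, azimuth]
    have hs : ∀ φ, α (transversal b c d τ (σ, φ) (-1)) = f (φ + Real.pi) := by
      intro φ
      simp only [hf, transversal, azimuth, Real.cos_add_pi, Real.sin_add_pi]
      congr 1
      module
    simp only [hs]
    rw [intervalIntegral.integral_comp_add_right]
    have := hp.intervalIntegral_add_eq (-Real.pi + Real.pi) (-Real.pi)
    rw [show -Real.pi + Real.pi + 2 * Real.pi = Real.pi + Real.pi by ring,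
      show -Real.pi + 2 * Real.pi = Real.pi by ring] at this
    exact this
  simp only [symMean, integral_div]
  rw [integral_add i1 i2, e2, sectionIntegral]
  simp only [e1]
  ring

theorem hasDerivAt_sectionIntegral (hd : 0 < d) (hα : ContDiff ℝ 2 α) {τ : ℝ} (hτ : d < τ) :
    HasDerivAt (sectionIntegral b c d α) (∫ s, symMeanDeriv b c α d τ s ∂(sectionMeasure d)) τ := by
  have := hasDerivAt_integral_section (d := d) isOpen_Ioi hτ
    (continuous_symMean b c hα.continuous).continuousOn
    (continuous_symMeanDeriv b c hα).continuousOn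
    (fun τ hτ s hs => hasDerivAt_symMean b c hd hα hτ hs.1)
  simpa only [integral_symMean b c hd.le hα.continuous] using this

/-- `symMeanDeriv` is continuous for every real `τ`, although it is known to be a derivative only
for `τ > d`; the limit is its value at `d`. -/
theorem tendsto_deriv_sectionIntegral (hα : ContDiff ℝ 2 α) :
    Tendsto (fun τ => ∫ s, symMeanDeriv b c α d τ s ∂(sectionMeasure d)) (𝓝[>] d)
      (𝓝 (∫ s, symMeanDeriv b c α d d s ∂(sectionMeasure d))) :=
  (continuousAt_integral_section (d := d) isOpen_univ trivial
    (continuous_symMeanDeriv b c hα).continuousOn).tendsto.mono_left nhdsWithin_le_nhds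

theorem transversal_focal (hd : 0 < d) (s : ℝ × ℝ) (u : ℝ) :
    transversal b c d d s u = c + (s.1 / 2) • b 0 := by
  have : d * s.1 / (2 * d) = s.1 / 2 := by field_simp
  simp [transversal, axialRadial, this]

theorem integral_cos_sin_quadratic (p q r : ℝ) :
    ∫ φ in (-Real.pi)..Real.pi,
      (Real.cos φ ^ 2 * p + 2 * (Real.cos φ * Real.sin φ) * q + Real.sin φ ^ 2 * r) =
      Real.pi * (p + r) := by
  have i1 : IntervalIntegrable (fun φ => Real.cos φ ^ 2 * p) volume (-Real.pi) Real.pi :=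
    Continuous.intervalIntegrable (by fun_prop) _ _
  have i2 : IntervalIntegrable (fun φ => 2 * (Real.cos φ * Real.sin φ) * q) volume
    (-Real.pi) Real.pi := Continuous.intervalIntegrable (by fun_prop) _ _
  have i3 : IntervalIntegrable (fun φ => Real.sin φ ^ 2 * r) volume (-Real.pi) Real.pi :=
    Continuous.intervalIntegrable (by fun_prop) _ _
  rw [intervalIntegral.integral_add (i1.add i2) i3, intervalIntegral.integral_add i1 i2]
  simp only [intervalIntegral.integral_mul_const, intervalIntegral.integral_const_mul,
    integral_cos_sq, integral_sin_sq, integral_sin_mul_cos₁, mul_comm (Real.cos _) (Real.sin _)]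
  simp
  ring

theorem hessian_azimuth (hα : ContDiff ℝ 2 α) (z : E3) (φ : ℝ) :
    hessian α z (azimuth b φ) = Real.cos φ ^ 2 * hessian α z (b 1) +
      2 * (Real.cos φ * Real.sin φ) * fderiv ℝ (fderiv ℝ α) z (b 1) (b 2) +
      Real.sin φ ^ 2 * hessian α z (b 2) := by
  have hsymm : fderiv ℝ (fderiv ℝ α) z (b 2) (b 1) = fderiv ℝ (fderiv ℝ α) z (b 1) (b 2) :=
    (hα.contDiffAt.isSymmSndFDerivAt (by simp)).eq (b 2) (b 1)
  simp only [hessian, azimuth, map_add, map_smul, add_apply,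
    smul_apply, smul_eq_mul, hsymm]
  ring

theorem laplacian_eq_sum_hessian (z : E3) :
    Laplacian.laplacian α z = hessian α z (b 0) + hessian α z (b 1) + hessian α z (b 2) := by
  rw [InnerProductSpace.laplacian_eq_iteratedFDeriv_orthonormalBasis α b]
  simp [Fin.sum_univ_three, iteratedFDeriv_two_apply, hessian]

/-- Integration by parts with the antiderivative `(σ² - d²)/(4d)`, chosen to vanish at `±d`. The
resulting weight is the one carried by the transversal second derivatives. -/
theorem integral_mul_fderiv_axis (hd : 0 < d) (hα : ContDiff ℝ 2 α) :
    ∫ σ in (-d)..d, fderiv ℝ α (c + (σ / 2) • b 0) (b 0) * (σ / (2 * d)) =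
      ∫ σ in (-d)..d, (d ^ 2 - σ ^ 2) / (8 * d) * hessian α (c + (σ / 2) • b 0) (b 0) := by
  have h3 := (contDiff_fderiv hα).continuous
  have h4 := continuous_fderiv_fderiv hα
  have hv : ∀ σ : ℝ, HasDerivAt (fun σ : ℝ => (σ ^ 2 - d ^ 2) / (4 * d)) (σ / (2 * d)) σ := by
    intro σ
    refine ((((hasDerivAt_id σ).pow 2).sub_const (d ^ 2)).div_const (4 * d)).congr_deriv ?_
    simp
    field_simp
    ring
  have hu : ∀ σ : ℝ, HasDerivAt (fun σ : ℝ => fderiv ℝ α (c + (σ / 2) • b 0) (b 0))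
      (1 / 2 * hessian α (c + (σ / 2) • b 0) (b 0)) σ := by
    intro σ
    have h1 : HasDerivAt (fun σ : ℝ => c + (σ / 2) • b 0) ((1 / 2 : ℝ) • b 0) σ :=
      (((hasDerivAt_id σ).div_const 2).smul_const (b 0)).const_add c
    have h2 := ((contDiff_fderiv hα).differentiable one_ne_zero _).hasFDerivAt.comp_hasDerivAt σ h1
    refine (h2.clm_apply (hasDerivAt_const σ (b 0))).congr_deriv ?_
    simp [hessian]
  rw [intervalIntegral.integral_mul_deriv_eq_deriv_mul (fun σ _ => hu σ) (fun σ _ => hv σ)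
    (Continuous.intervalIntegrable (by unfold hessian; fun_prop) _ _)
    (Continuous.intervalIntegrable (by fun_prop) _ _)]
  simp only [even_two, Even.neg_pow, sub_self, zero_div, mul_zero, zero_sub]
  rw [← intervalIntegral.integral_neg]
  congr 1
  ext σ
  field_simp
  ring

/-- On the focal segment the integrand in `u` is constant. The mean over `φ` then kills the mixed
second derivative. -/
theorem integral_symMeanDeriv_azimuth (hd : 0 < d) (hα : ContDiff ℝ 2 α) (σ : ℝ) :
    ∫ φ in (-Real.pi)..Real.pi, symMeanDeriv b c α d d (σ, φ) =
      2 * Real.pi * (fderiv ℝ α (c + (σ / 2) • b 0) (b 0) * (σ / (2 * d))) +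
      2 * Real.pi * ((d ^ 2 - σ ^ 2) / (8 * d) * (hessian α (c + (σ / 2) • b 0) (b 1) +
        hessian α (c + (σ / 2) • b 0) (b 2))) := by
  have e : ∀ φ, symMeanDeriv b c α d d (σ, φ) =
      fderiv ℝ α (c + (σ / 2) • b 0) (b 0) * (σ / (2 * d)) +
      (d ^ 2 - σ ^ 2) / (4 * d) * (Real.cos φ ^ 2 * hessian α (c + (σ / 2) • b 0) (b 1) +
        2 * (Real.cos φ * Real.sin φ) *
          fderiv ℝ (fderiv ℝ α) (c + (σ / 2) • b 0) (b 1) (b 2) +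
        Real.sin φ ^ 2 * hessian α (c + (σ / 2) • b 0) (b 2)) := by
    intro φ
    simp only [symMeanDeriv, transversal_focal b c hd, intervalIntegral.integral_const,
      hessian_azimuth b hα, smul_eq_mul]
    field_simp
    ring
  simp only [e]
  rw [intervalIntegral.integral_add (by simp) (Continuous.intervalIntegrable (by fun_prop) _ _),
    intervalIntegral.integral_const, intervalIntegral.integral_const_mul,
    integral_cos_sin_quadratic, smul_eq_mul]
  field_simp
  ring

theorem integral_symMeanDeriv_focal (hd : 0 < d) (hα : ContDiff ℝ 2 α) :
    ∫ s, symMeanDeriv b c α d d s ∂(sectionMeasure d) =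
      Real.pi / (4 * d) *
        ∫ σ in (-d)..d, (d ^ 2 - σ ^ 2) * Laplacian.laplacian α (c + (σ / 2) • b 0) := by
  have h3 := (contDiff_fderiv hα).continuous
  have h4 := continuous_fderiv_fderiv hα
  have hc : Continuous (symMeanDeriv b c α d d) :=
    (continuous_symMeanDeriv b c (d := d) hα).uncurry_left d
  rw [integral_sectionMeasure hd.le hc]
  simp only [integral_symMeanDeriv_azimuth b c hd hα]
  have hH : ∀ v, Continuous fun σ : ℝ => hessian α (c + (σ / 2) • b 0) v := by
    intro v
    unfold hessian
    fun_prop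
  have hH0 := hH (b 0)
  have hH1 := hH (b 1)
  have hH2 := hH (b 2)
  rw [intervalIntegral.integral_add (Continuous.intervalIntegrable (by fun_prop) _ _)
      (Continuous.intervalIntegrable (by fun_prop) _ _),
    intervalIntegral.integral_const_mul, integral_mul_fderiv_axis b c hd hα,
    ← intervalIntegral.integral_const_mul,
    ← intervalIntegral.integral_add (Continuous.intervalIntegrable (by fun_prop) _ _)
      (Continuous.intervalIntegrable (by fun_prop) _ _),
    ← intervalIntegral.integral_const_mul]
  congr 1
  ext σ
  rw [laplacian_eq_sum_hessian b]
  field_simp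
  ring

end Symmetrised

/-! ### The kernel as a sum of one-dimensional integrals, and its limits. -/

section Kernel

variable (b : OrthonormalBasis (Fin 3) ℝ E3) (c : E3) {d : ℝ} (ε : ℝ) {α ρ : E3 → ℝ}

theorem kernelAlpha_eq (α : E3 → ℝ) (x y : E3) : kernelAlpha ε α x y =
    fun z => ε / (16 * Real.pi ^ 2) *
      ((fun _ : ℝ => (1 : ℝ)) (‖z - x‖ + ‖z - y‖) / (‖z - x‖ * ‖z - y‖) * α z) := by
  ext z
  simp only [kernelAlpha, div_eq_mul_inv, mul_inv]
  ring

theorem kernelRhoA_eq (ρ : E3 → ℝ) (x y : E3) (t : ℝ) : kernelRhoA ε ρ x y t =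
    fun z => ε / (16 * Real.pi ^ 2) *
      ((fun τ : ℝ => t - τ) (‖z - x‖ + ‖z - y‖) / (‖z - x‖ * ‖z - y‖) * radialGrad ρ y z) := by
  ext z
  simp only [kernelRhoA, div_eq_mul_inv, mul_inv]
  ring

theorem kernelRhoB_eq (ρ : E3 → ℝ) (x y : E3) (t : ℝ) : kernelRhoB ε ρ x y t =
    fun z => ε / (32 * Real.pi ^ 2) *
      ((fun τ : ℝ => (t - τ) ^ 2) (‖z - x‖ + ‖z - y‖) / (‖z - x‖ * ‖z - y‖) *
        radialGradDiv ρ y z) := by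
  ext z
  simp only [kernelRhoB, radialGradDiv, div_eq_mul_inv, mul_inv, pow_two]
  ring

theorem integrableOn_kernels (hd : 0 < d) (hα : Continuous α) (hρ : ContDiff ℝ 1 ρ) (t : ℝ) :
    IntegrableOn (kernelAlpha ε α (c - (d / 2) • b 0) (c + (d / 2) • b 0))
      (spheroid (c - (d / 2) • b 0) (c + (d / 2) • b 0) t) ∧
    IntegrableOn (kernelRhoA ε ρ (c - (d / 2) • b 0) (c + (d / 2) • b 0) t)
      (spheroid (c - (d / 2) • b 0) (c + (d / 2) • b 0) t) ∧
    IntegrableOn (kernelRhoB ε ρ (c - (d / 2) • b 0) (c + (d / 2) • b 0) t)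
      (spheroid (c - (d / 2) • b 0) (c + (d / 2) • b 0) t) := by
  rw [kernelAlpha_eq, kernelRhoA_eq, kernelRhoB_eq]
  refine ⟨Integrable.const_mul (integrableOn_spheroid b c hd t hα.measurable
      (q := fun _ => 1) measurable_const (integrable_mul_spheroidal b c (q := fun _ => 1)
        continuous_const (integrable_continuous_spheroidal b c hα t))) _,
    Integrable.const_mul (integrableOn_spheroid b c hd t (measurable_radialGrad hρ _)
      (q := fun τ => t - τ) (by fun_prop) (integrable_mul_spheroidal b c (by fun_prop)
        (integrable_radialGrad_spheroidal b c hρ _ t))) _,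
    Integrable.const_mul (integrableOn_spheroid b c hd t (measurable_radialGradDiv hρ _)
      (q := fun τ => (t - τ) ^ 2) (by fun_prop)
      (integrable_mul_spheroidal b c (q := fun τ => (t - τ) ^ 2) (by fun_prop)
        (integrable_radialGradDiv_spheroidal b c hd hρ t))) _⟩

theorem waveKernel_eq (hd : 0 < d) (hα : Continuous α) (hρ : ContDiff ℝ 1 ρ) {t : ℝ}
    (ht : d ≤ t) (x y : E3) (hx : x = c - (d / 2) • b 0) (hy : y = c + (d / 2) • b 0)
    (hxy : ‖y - x‖ = d) :
    waveKernel ε α ρ x y t =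
      (t - d) ^ 2 / (8 * Real.pi * d) * (1 - ε * α y) +
      ε / (32 * Real.pi ^ 2 * d) * (∫ τ in d..t, sectionIntegral b c d α τ) +
      ε / (32 * Real.pi ^ 2 * d) *
        (∫ τ in d..t, (t - τ) * sectionIntegral b c d (radialGrad ρ y) τ) +
      ε / (64 * Real.pi ^ 2 * d) *
        (∫ τ in d..t, (t - τ) ^ 2 * sectionIntegral b c d (radialGradDiv ρ y) τ) := by
  rw [waveKernel, hxy, kernelAlpha_eq, kernelRhoA_eq, kernelRhoB_eq]
  simp only [integral_const_mul]
  subst hx hy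
  have e1 := setIntegral_spheroid b c hd t hα.measurable (q := fun _ => 1) (by fun_prop)
    (integrable_mul_spheroidal b c (q := fun _ => 1) continuous_const
      (integrable_continuous_spheroidal b c hα t))
  have e2 := setIntegral_spheroid b c hd t (measurable_radialGrad hρ (c + (d / 2) • b 0))
    (q := fun τ => t - τ) (by fun_prop) (integrable_mul_spheroidal b c (by fun_prop)
      (integrable_radialGrad_spheroidal b c hρ _ t))
  have e3 := setIntegral_spheroid b c hd t (measurable_radialGradDiv hρ (c + (d / 2) • b 0))
    (q := fun τ => (t - τ) ^ 2) (by fun_prop)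
      (integrable_mul_spheroidal b c (q := fun τ => (t - τ) ^ 2) (by fun_prop)
      (integrable_radialGradDiv_spheroidal b c hd hρ t))
  rw [e1, e2, e3]
  simp only [intervalIntegral.integral_of_le ht, sectionIntegral, one_mul]
  field_simp
  ring

theorem segmentIntegral_axis (hd : 0 < d) (f : E3 → ℝ) :
    segmentIntegral f (c - (d / 2) • b 0) (c + (d / 2) • b 0) =
      1 / 2 * ∫ σ in (-d)..d, f (c + (σ / 2) • b 0) := by
  have e : c + (d / 2) • b 0 - (c - (d / 2) • b 0) = d • b 0 := by module
  have hn : ‖d • b 0‖ = d := by simp [norm_smul, hd.le]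
  rw [segmentIntegral, e, hn]
  -- The arc length `s` and the coordinate `σ` are related by `σ = 2s - d`, whence the factor `1/2`.
  have h := intervalIntegral.integral_comp_mul_sub (fun σ => f (c + (σ / 2) • b 0))
    (two_ne_zero (α := ℝ)) d (a := 0) (b := d)
  rw [show 2 * d - d = d by ring, show 2 * (0 : ℝ) - d = -d by ring, smul_eq_mul] at h
  rw [one_div, ← h]
  congr 1
  ext s
  congr 1
  rw [smul_smul, div_mul_cancel₀ _ hd.ne']
  module

/-- Regularity of a kernel with the structure of `waveKernel` in terms of its densities. -/
theorem deriv_kernel_form {K hA hG hB hA' : ℝ → ℝ} {C₀ C₁ C₂ C₃ LA LA' LG : ℝ}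
    (hK : ∀ t, d ≤ t → K t = (t - d) ^ 2 * C₀ + C₁ * (∫ τ in d..t, hA τ) +
      C₂ * (∫ τ in d..t, (t - τ) * hG τ) + C₃ * (∫ τ in d..t, (t - τ) ^ 2 * hB τ))
    (iA : ∀ t, d ≤ t → IntervalIntegrable hA volume d t)
    (iG : ∀ t, d ≤ t → IntervalIntegrable hG volume d t)
    (iB : ∀ t, d ≤ t → IntervalIntegrable hB volume d t)
    (dA : ∀ t, d < t → HasDerivAt hA (hA' t) t)
    (cG : ∀ t, d < t → ContinuousAt hG t) (cB : ∀ t, d < t → ContinuousAt hB t)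
    (lA : Tendsto hA (𝓝[>] d) (𝓝 LA)) (lA' : Tendsto hA' (𝓝[>] d) (𝓝 LA'))
    (lG : Tendsto hG (𝓝[>] d) (𝓝 LG)) :
    (∀ t, d < t → DifferentiableAt ℝ K t ∧ DifferentiableAt ℝ (deriv K) t) ∧
    Tendsto (deriv K) (𝓝[>] d) (𝓝 (C₁ * LA)) ∧
    Tendsto (deriv (deriv K)) (𝓝[>] d) (𝓝 (2 * C₀ + C₁ * LA' + C₂ * LG)) := by
  have cA : ∀ t, d < t → ContinuousAt hA t := fun t ht => (dA t ht).continuousAt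
  have k1 : ∀ t, d < t → HasDerivAt K (2 * (t - d) * C₀ + C₁ * hA t + C₂ * (∫ τ in d..t, hG τ) +
      C₃ * (2 * ∫ τ in d..t, (t - τ) * hB τ)) t := by
    intro t ht
    have e0 : HasDerivAt (fun t : ℝ => (t - d) ^ 2 * C₀) (2 * (t - d) * C₀) t := by
      refine ((((hasDerivAt_id t).sub_const d).pow 2).mul_const C₀).congr_deriv ?_
      simp
    exact (((e0.add ((hasDerivAt_integral_sub_mul iA cA ht).1.const_mul C₁)).add
      ((hasDerivAt_integral_sub_mul iG cG ht).2.1.const_mul C₂)).add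
      ((hasDerivAt_integral_sub_mul iB cB ht).2.2.const_mul C₃)).congr_of_eventuallyEq
        ((eventually_ge_nhds ht).mono hK)
  have k2 : ∀ t, d < t → HasDerivAt (deriv K) (2 * C₀ + C₁ * hA' t + C₂ * hG t +
      C₃ * (2 * ∫ τ in d..t, hB τ)) t := by
    intro t ht
    have e0 : HasDerivAt (fun t : ℝ => 2 * (t - d) * C₀) (2 * C₀) t := by
      refine ((((hasDerivAt_id t).sub_const d).const_mul 2).mul_const C₀).congr_deriv ?_
      simp
    exact (((e0.add ((dA t ht).const_mul C₁)).add
      ((hasDerivAt_integral_sub_mul iG cG ht).1.const_mul C₂)).add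
      (((hasDerivAt_integral_sub_mul iB cB ht).2.1.const_mul 2).const_mul C₃)).congr_of_eventuallyEq
        ((eventually_gt_nhds ht).mono fun s hs => (k1 s hs).deriv)
  have hid : Tendsto (fun t : ℝ => t - d) (𝓝[>] d) (𝓝 0) := by
    have : Continuous fun t : ℝ => t - d := by fun_prop
    simpa using (this.tendsto d).mono_left (nhdsWithin_le_nhds (s := Set.Ioi d))
  refine ⟨fun t ht => ⟨(k1 t ht).differentiableAt, (k2 t ht).differentiableAt⟩, ?_, ?_⟩
  · have iB1 : ∀ t, d ≤ t → IntervalIntegrable (fun τ => τ * hB τ) volume d t := fun t ht =>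
      (iB t ht).continuousOn_mul continuousOn_id
    -- Splitting off `t` reduces this to two primitives, each tending to `0` at `d`.
    have lB : Tendsto (fun t => ∫ τ in d..t, (t - τ) * hB τ) (𝓝[>] d) (𝓝 0) := by
      have hlim := (((tendsto_nhdsWithin_of_tendsto_nhds tendsto_id).mul
        (tendsto_integral_nhdsGT iB)).sub (tendsto_integral_nhdsGT iB1) :
          Tendsto _ (𝓝[>] d) (𝓝 (d * 0 - 0)))
      rw [mul_zero, sub_zero] at hlim
      refine hlim.congr' ?_
      filter_upwards [self_mem_nhdsWithin] with t ht
      have ht' : d ≤ t := le_of_lt ht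
      simp only [id]
      rw [← intervalIntegral.integral_const_mul, ← intervalIntegral.integral_sub
        ((iB t ht').const_mul t) (iB1 t ht')]
      congr 1; ext τ; ring
    have hlim := ((((hid.const_mul 2).mul_const C₀).add (lA.const_mul C₁)).add
      ((tendsto_integral_nhdsGT iG).const_mul C₂)).add ((lB.const_mul 2).const_mul C₃)
    simp only [mul_zero, zero_mul, zero_add, add_zero] at hlim
    refine hlim.congr' ?_
    filter_upwards [self_mem_nhdsWithin] with t ht using (k1 t ht).deriv.symm
  · have hlim := (((lA'.const_mul C₁).const_add (2 * C₀)).add (lG.const_mul C₂)).add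
      (((tendsto_integral_nhdsGT iB).const_mul 2).const_mul C₃)
    simp only [mul_zero, add_zero] at hlim
    refine hlim.congr' ?_
    filter_upwards [self_mem_nhdsWithin] with t ht using (k2 t ht).deriv.symm

theorem tendsto_sectionIntegral (hd : 0 < d) (hα : Continuous α) :
    Tendsto (sectionIntegral b c d α) (𝓝[>] d)
      (𝓝 (2 * Real.pi * ∫ σ in (-d)..d, α (c + (σ / 2) • b 0))) := by
  have hval : sectionIntegral b c d α d = 2 * Real.pi * ∫ σ in (-d)..d, α (c + (σ / 2) • b 0) := by
    simp only [sectionIntegral, spheroidal_focal b c hd]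
    rw [integral_sectionMeasure hd.le (by fun_prop)]
    simp only [intervalIntegral.integral_const, smul_eq_mul, intervalIntegral.integral_const_mul]
    ring
  rw [← hval]
  have : ContinuousAt (sectionIntegral b c d α) d :=
    continuousAt_integral_section (d := d) isOpen_univ trivial
      (hα.comp (continuous_spheroidal b c)).continuousOn
  exact this.tendsto.mono_left nhdsWithin_le_nhds

/-- The unit vector from `x` towards `y` extends to an orthonormal basis. -/
theorem exists_axis {x y : E3} (hxy : x ≠ y) :
    ∃ b : OrthonormalBasis (Fin 3) ℝ E3, y - x = ‖y - x‖ • b 0 := by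
  have hn : ‖y - x‖ ≠ 0 := norm_ne_zero_iff.2 (sub_ne_zero.2 hxy.symm)
  have ho : Orthonormal ℝ (({0} : Set (Fin 3)).domRestrict
      fun _ : Fin 3 => ‖y - x‖⁻¹ • (y - x)) := by
    refine ⟨fun i => ?_, fun i j hij => (hij (Subsingleton.elim i j)).elim⟩
    simp [Set.domRestrict, norm_smul, hn]
  obtain ⟨b, hb⟩ := ho.exists_orthonormalBasis_extension_of_card_eq (by simp)
  refine ⟨b, ?_⟩
  rw [hb 0 rfl, smul_smul, mul_inv_cancel₀ hn, one_smul]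

end Kernel

theorem mainTheorem3 (ε : ℝ) (α₁ ρ₁ : E3 → ℝ) (hα : ContDiff ℝ 2 α₁) (hρ : ContDiff ℝ 1 ρ₁)
    (x y : E3) (hxy : x ≠ y) :
    -- the integrals defining the kernel converge
    (∀ t : ℝ, IntegrableOn (kernelAlpha ε α₁ x y) (spheroid x y t) ∧
      IntegrableOn (kernelRhoA ε ρ₁ x y t) (spheroid x y t) ∧
      IntegrableOn (kernelRhoB ε ρ₁ x y t) (spheroid x y t)) ∧
    -- the kernel is twice differentiable in time after the arrival time
    (∀ t : ℝ, ‖y - x‖ < t →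
      DifferentiableAt ℝ (waveKernel ε α₁ ρ₁ x y) t ∧
      DifferentiableAt ℝ (deriv (waveKernel ε α₁ ρ₁ x y)) t) ∧
    Tendsto (deriv (waveKernel ε α₁ ρ₁ x y)) (𝓝[>] ‖y - x‖)
      (𝓝 (1 / (8 * Real.pi * ‖y - x‖) * segmentIntegral (fun z => ε * α₁ z) x y)) ∧
    Tendsto (deriv (deriv (waveKernel ε α₁ ρ₁ x y))) (𝓝[>] ‖y - x‖)
      (𝓝 ((1 - ε * α₁ y) / (4 * Real.pi * ‖y - x‖)
        + (ε * ρ₁ x - ε * ρ₁ y) / (8 * Real.pi * ‖y - x‖)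
        + 1 / (16 * Real.pi * ‖y - x‖) *
          segmentIntegral
            (fun z => (1 - ‖z - x‖ / ‖y - x‖) * ‖z - x‖ * (ε * Laplacian.laplacian α₁ z))
            x y)) := by
  obtain ⟨b, hb⟩ := exists_axis hxy
  have hd : 0 < ‖y - x‖ := norm_pos_iff.2 (sub_ne_zero.2 hxy.symm)
  obtain ⟨d, hdef⟩ : ∃ d, ‖y - x‖ = d := ⟨_, rfl⟩
  rw [hdef] at hd hb ⊢
  -- The centre is the midpoint of the foci.
  obtain ⟨c, hc⟩ : ∃ c, c = x + (d / 2) • b 0 := ⟨_, rfl⟩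
  have hx : x = c - (d / 2) • b 0 := by rw [hc]; module
  have hy : y = c + (d / 2) • b 0 := by
    rw [sub_eq_iff_eq_add'.1 hb, hc]; module
  have main := deriv_kernel_form (d := d) (K := waveKernel ε α₁ ρ₁ x y)
    (hB := sectionIntegral b c d (radialGradDiv ρ₁ y))
    (C₀ := (1 - ε * α₁ y) / (8 * Real.pi * d)) (C₁ := ε / (32 * Real.pi ^ 2 * d))
    (C₂ := ε / (32 * Real.pi ^ 2 * d)) (C₃ := ε / (64 * Real.pi ^ 2 * d))
    (fun t ht => (waveKernel_eq b c ε hd hα.continuous hρ ht x y hx hy hdef).trans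
      (by rw [div_mul_eq_mul_div, mul_div_assoc (_ ^ 2)]))
    (fun t ht => intervalIntegrable_sectionIntegral b c
      (integrable_continuous_spheroidal b c hα.continuous) ht)
    (fun t ht => intervalIntegrable_sectionIntegral b c
      (integrable_radialGrad_spheroidal b c hρ y) ht)
    (fun t ht => intervalIntegrable_sectionIntegral b c
      (hy ▸ integrable_radialGradDiv_spheroidal b c hd hρ) ht)
    (fun t ht => hasDerivAt_sectionIntegral b c hd hα ht)
    (fun t ht => continuousAt_sectionIntegral b c hd (hy ▸ continuousOn_radialGrad hρ y) ht)
    (fun t ht => continuousAt_sectionIntegral b c hd (hy ▸ continuousOn_radialGradDiv hρ y) ht)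
    (tendsto_sectionIntegral b c hd hα.continuous)
    (tendsto_deriv_sectionIntegral b c hα)
    (by rw [hy]; exact tendsto_sectionIntegral_radialGrad b c hd hρ)
  refine ⟨?_, main.1, ?_, ?_⟩
  · rw [hx, hy]
    exact integrableOn_kernels b c ε hd hα.continuous hρ
  · convert main.2.1 using 2
    rw [hx, hy, segmentIntegral_axis b c hd, intervalIntegral.integral_const_mul]
    field_simp
    ring
  · convert main.2.2 using 2
    rw [integral_symMeanDeriv_focal b c hd hα]
    have hseg : segmentIntegral
        (fun z => (1 - ‖z - x‖ / d) * ‖z - x‖ * (ε * Laplacian.laplacian α₁ z)) x y =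
        ε / (8 * d) * ∫ σ in (-d)..d, (d ^ 2 - σ ^ 2) *
          Laplacian.laplacian α₁ (c + (σ / 2) • b 0) := by
      conv_lhs => rw [hx, hy]
      rw [segmentIntegral_axis b c hd, ← intervalIntegral.integral_const_mul,
        ← intervalIntegral.integral_const_mul]
      refine intervalIntegral.integral_congr fun σ hσ => ?_
      rw [Set.uIcc_of_le (by linarith)] at hσ
      -- On the segment `|z - x| = (σ + d)/2`, so the weight `(1 - |z - x|/d)|z - x|` equals `(d² -
      -- σ²)/(4d)`.
      have e : c + (σ / 2) • b 0 - (c - (d / 2) • b 0) = ((σ + d) / 2) • b 0 := by module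
      have hn : ‖c + (σ / 2) • b 0 - (c - (d / 2) • b 0)‖ = (σ + d) / 2 := by
        rw [e, norm_smul, b.norm_eq_one, mul_one, Real.norm_of_nonneg (by linarith [hσ.1])]
      simp only [hn]
      field_simp
      ring
    rw [hseg, ← hx, ← hy]
    field_simp
    ring
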